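/- Let $H\in(0,1)$, $T>0$. Let $\mathfrak H$ be the Hilbert space obtained by completing the step functions on $[0,T]$ under $\langle 1_{[0,t]},1_{[0,s]}\rangle_{\mathfrak H}=\frac12(t^{2H}+s^{2H}-|t-s|^{2H})$, let $\mathbb W=(\mathbb W(h))_{h\in\mathfrak H}$ be an isonormal Gaussian process on a probability space $(\Omega,\mathcal F,P)$, and let $B_t=\mathbb W(1_{[0,t]})$, a fractional Brownian motion with Hurst coefficient $H$. Let $I_2$ denote the double Wiener integral ($I_2(h^{\otimes2})=\mathbb W(h)^2-\|h\|_{\mathfrak H}^2$). For $t^n_j=jT/n$ put $1^n_j=1_{(t^n_{j-1},t^n_j]}$, $$V_n=\sum_{j=1}^{n-1}(B_{t^n_{j+1}}-2B_{t^n_j}+B_{t^n_{j-1}})^2,\qquad M_n=-\sqrt n\Big\{\Big[\tfrac{V_{2n}}{E[V_{2n}]}-1\Big]-\Big[\tfrac{V_n}{E[V_n]}-1\Big]\Big\},$$ $$f^{[\alpha]}_n=\frac{\sqrt n\sum_{j=1}^{\alpha n-1}(1^{\alpha n}_{j+1}-1^{\alpha n}_j)^{\otimes2}}{E[V_{\alpha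 n}]}\ (\alpha=1,2),\qquad \widetilde G_n=2I_2(f^{[2]}_n\otimes_1f^{[2]}_n)-4I_2(f^{[2]}_n\odot_1f^{[1]}_n)+2I_2(f^{[1]}_n\otimes_1f^{[1]}_n),$$ where $\otimes_1$ is the contraction of order one and $\odot_1$ its symmetrization. For $j\in\mathbb Z$ let $$\widehat\rho(j)=\tfrac12\{-|j-2|^{2H}+4|j-1|^{2H}-6|j|^{2H}+4|j+1|^{2H}-|j+2|^{2H}\},$$ $$\widetilde\rho(j)=2^{-2H-1}\{-|j-3|^{2H}+2|j-2|^{2H}+|j-1|^{2H}-4|j|^{2H}+|j+1|^{2H}+2|j+2|^{2H}-|j+3|^{2H}\},$$ and, with $c=4-2^{2H}$, $$\Sigma_{11}=2\Big[1+\tfrac2{c^2}\sum_{i\ge1}\widehat\rho(i)^2\Big],\quad \Sigma_{22}=\tfrac12\Sigma_{11},\quad \Sigma_{12}=\tfrac{2^{2H}}{c^2}\sum_{\ell\in\mathbb Z}\widetilde\rho(\ell)^2,\quad G_\infty=\Sigma_{22}-2\Sigma_{12}+\Sigma_{11}.$$ With all sums over $\mathbb Z$, let $$\kappa(1;1,1)=c^{-3}\sum_{i_1,i_2}\widehat\rho(i_1)\widehat\rho(i_1-i_2)\widehat\rho(i_2),\qquad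 \kappa(2;2,2)=\tfrac14\kappa(1;1,1),$$ $$\kappa(2;1,1)=\kappa(1;1,2)=2^{2H-1}c^{-3}\sum_{i_1,i_2}\widehat\rho(i_1)\widetilde\rho(i_2-2i_1)\widetilde\rho(i_2),$$ $$\kappa(1;2,2)=\kappa(2;1,2)=2^{2H-2}c^{-3}\sum_{i_1,i_2}\widehat\rho(i_1)\widetilde\rho(i_1-i_2)\widetilde\rho(i_2),$$ $$\kappa(1,1;1,1)=c^{-4}\sum_{i_1,i_2,i_3}\widehat\rho(i_1)\widehat\rho(i_1-i_2)\widehat\rho(i_2-i_3)\widehat\rho(i_3),\qquad \kappa(2,2;2,2)=\tfrac18\kappa(1,1;1,1),$$ $$\kappa(1,1;2,2)=2^{2H-2}c^{-4}\sum_{i_1,i_2,i_3}\{\widetilde\rho(2i_1)\widehat\rho(i_1-i_2)\widetilde\rho(2i_2-i_3)\widehat\rho(i_3)+\widetilde\rho(2i_1+1)\widehat\rho(i_1-i_2)\widetilde\rho(2i_2-i_3+1)\widehat\rho(i_3)\},$$ $$\kappa(1,1;1,2)=2^{2H-1}c^{-4}\sum_{i_1,i_2,i_3}\widehat\rho(i_1)\widetilde\rho(2i_1-i_2)\widetilde\rho(i_2-2i_3)\widehat\rho(i_3),$$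 $$\kappa(1,2;2,2)=2^{2H-3}c^{-4}\sum_{i_1,i_2,i_3}\widehat\rho(i_1)\widehat\rho(i_1-i_2)\widetilde\rho(i_2-i_3)\widetilde\rho(i_3),$$ $$\kappa(1,2;1,2)=2^{2H-3}c^{-4}\sum_{i_1,i_2,i_3}\widehat\rho(i_1)\widetilde\rho(2i_1-i_2)\widehat\rho(i_2-i_3)\widetilde\rho(i_3)$$ $$\qquad+2^{4H-3}c^{-4}\Big\{\sum_{i_1,i_2,i_3}\widetilde\rho(2i_1)\widetilde\rho(2i_1-i_2)\widetilde\rho(i_2-2i_3)\widetilde\rho(2i_3)+\sum_{i_1,i_2,i_3}\widetilde\rho(2i_1+1)\widetilde\rho(2i_1-i_2)\widetilde\rho(i_2-2i_3)\widetilde\rho(2i_3+1)\Big\}.$$ Let $\mathfrak U$ be the symmetric $3\times3$ matrix with $\mathfrak U_{11}=\Sigma_{11}$, $\mathfrak U_{12}=\Sigma_{12}$, $\mathfrak U_{22}=\Sigma_{22}$, $$\mathfrak U_{13}=4\kappa(1;2,2)-8\kappa(1;1,2)+4\kappa(1;1,1),\qquad \mathfrak U_{23}=4\kappa(2;2,2)-8\kappa(2;1,2)+4\kappa(2;1,1),$$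 $$\mathfrak U_{33}=8\kappa(2,2;2,2)+32\kappa(1,2;1,2)+8\kappa(1,1;1,1)-32\kappa(1,2;2,2)+16\kappa(1,1;2,2)-32\kappa(1,1;1,2),$$ and let $\mathfrak T$ be the symmetric $2\times2$ matrix with $\mathfrak T_{11}=\mathfrak U_{11}-2\mathfrak U_{12}+\mathfrak U_{22}$, $\mathfrak T_{12}=\mathfrak U_{13}-\mathfrak U_{23}$, $\mathfrak T_{22}=\mathfrak U_{33}$. Then all these series converge absolutely, $\mathfrak T$ is positive semidefinite, and $T_n=(M_n,n^{1/2}\widetilde G_n)$ converges in distribution to the centered normal law $N_2(0,\mathfrak T)$ as $n\to\infty$. Moreover $$G_\infty=\mathfrak T_{11}=\Sigma_{22}-2\Sigma_{12}+\Sigma_{11}=\tfrac32\Sigma_{11}-2\Sigma_{12}\ge\big(\tfrac32-\sqrt2\big)\Sigma_{11}>0.$$ -/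

import Mathlib

open MeasureTheory ProbabilityTheory Filter
open scoped TensorProduct InnerProductSpace

namespace FracBM

noncomputable section

/-- The covariance function of fractional Brownian motion with Hurst coefficient `H`. -/
def covKernel (H s t : ℝ) : ℝ :=
  (t ^ (2 * H) + s ^ (2 * H) - |t - s| ^ (2 * H)) / 2

theorem covKernel_symm (H s t : ℝ) : covKernel H s t = covKernel H t s := by
  rw [covKernel, covKernel, abs_sub_comm]; ring

theorem integrableOn_one_sub_cos {H : ℝ} (h0 : 0 < H) (h1 : H < 1) (t : ℝ) :
    IntegrableOn (fun x : ℝ => (1 - Real.cos (t * x)) * x ^ (-1 - 2 * H)) (Set.Ioi 0) := by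
  have hmeas : AEStronglyMeasurable
      (fun x : ℝ => (1 - Real.cos (t * x)) * x ^ (-1 - 2 * H)) := by
    apply Measurable.aestronglyMeasurable
    fun_prop
  rw [← Set.Ioc_union_Ioi_eq_Ioi (zero_le_one' ℝ)]
  refine IntegrableOn.union ?_ ?_
  · have hi : IntegrableOn (fun x : ℝ => t ^ 2 / 2 * x ^ (1 - 2 * H)) (Set.Ioc 0 1) := by
      refine Integrable.const_mul ?_ _
      have := intervalIntegral.intervalIntegrable_rpow' (a := 0) (b := 1) (r := 1 - 2 * H)
        (by linarith)
      rwa [intervalIntegrable_iff_integrableOn_Ioc_of_le zero_le_one] at this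
    refine Integrable.mono' hi hmeas.restrict ?_
    refine (ae_restrict_iff' measurableSet_Ioc).2 (Eventually.of_forall fun x hx => ?_)
    have hx0 : 0 < x := hx.1
    have hc : 0 ≤ 1 - Real.cos (t * x) := by linarith [Real.cos_le_one (t * x)]
    rw [Real.norm_of_nonneg (mul_nonneg hc (Real.rpow_nonneg hx0.le _))]
    have e : x ^ (1 - 2 * H) = x ^ 2 * x ^ (-1 - 2 * H) := by
      rw [← Real.rpow_natCast, ← Real.rpow_add hx0]; congr 1; push_cast; ring
    rw [e, ← mul_assoc]
    refine mul_le_mul_of_nonneg_right ?_ (Real.rpow_nonneg hx0.le _)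
    have := Real.one_sub_sq_div_two_le_cos (x := t * x)
    nlinarith
  · have hi : IntegrableOn (fun x : ℝ => 2 * x ^ (-1 - 2 * H)) (Set.Ioi 1) :=
      (integrableOn_Ioi_rpow_of_lt (by linarith) one_pos).const_mul 2
    refine Integrable.mono' hi hmeas.restrict ?_
    refine (ae_restrict_iff' measurableSet_Ioi).2 (Eventually.of_forall fun x hx => ?_)
    have hx0 : 0 < x := lt_trans one_pos hx
    have hc : 0 ≤ 1 - Real.cos (t * x) := by linarith [Real.cos_le_one (t * x)]
    rw [Real.norm_of_nonneg (mul_nonneg hc (Real.rpow_nonneg hx0.le _))]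
    exact mul_le_mul_of_nonneg_right (by linarith [Real.neg_one_le_cos (t * x)])
      (Real.rpow_nonneg hx0.le _)

theorem integral_one_sub_cos {H : ℝ} (h0 : 0 < H) (t : ℝ) :
    ∫ x in Set.Ioi (0 : ℝ), (1 - Real.cos (t * x)) * x ^ (-1 - 2 * H) =
      |t| ^ (2 * H) * ∫ x in Set.Ioi (0 : ℝ), (1 - Real.cos (1 * x)) * x ^ (-1 - 2 * H) := by
  rcases eq_or_ne t 0 with rfl | ht
  · simp [Real.zero_rpow (by positivity : 2 * H ≠ 0)]
  have ht' : 0 < |t| := abs_pos.2 ht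
  have key := integral_comp_mul_left_Ioi
    (fun x : ℝ => (1 - Real.cos (1 * x)) * x ^ (-1 - 2 * H)) 0 ht'
  rw [mul_zero] at key
  have e : ∀ x ∈ Set.Ioi (0 : ℝ), (1 - Real.cos (t * x)) * x ^ (-1 - 2 * H) =
      |t| ^ (1 + 2 * H) * ((1 - Real.cos (1 * (|t| * x))) * (|t| * x) ^ (-1 - 2 * H)) := by
    intro x hx
    have hx0 : (0 : ℝ) < x := hx
    have hcos : Real.cos (1 * (|t| * x)) = Real.cos (t * x) := by
      rw [one_mul, ← Real.cos_abs (t * x), abs_mul, abs_of_pos hx0]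
    rw [hcos, Real.mul_rpow ht'.le hx0.le]
    have : |t| ^ (1 + 2 * H) * |t| ^ (-1 - 2 * H) = 1 := by
      rw [← Real.rpow_add ht']; ring_nf; simp
    linear_combination (-(1 - Real.cos (t * x)) * x ^ (-1 - 2 * H)) * this
  rw [setIntegral_congr_fun measurableSet_Ioi e, integral_const_mul, key, smul_eq_mul, ← mul_assoc]
  congr 1
  rw [Real.rpow_add ht', Real.rpow_one]
  field_simp

theorem integral_one_sub_cos_pos {H : ℝ} (h0 : 0 < H) (h1 : H < 1) :
    0 < ∫ x in Set.Ioi (0 : ℝ), (1 - Real.cos (1 * x)) * x ^ (-1 - 2 * H) := by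
  rw [setIntegral_pos_iff_support_of_nonneg_ae _ (integrableOn_one_sub_cos h0 h1 1)]
  · refine lt_of_lt_of_le ?_ (measure_mono (s := Set.Ioo (0 : ℝ) 1) ?_)
    · simp
    · intro x hx
      refine ⟨?_, hx.1⟩
      have hlt : Real.cos (1 * x) < 1 := by
        rw [one_mul, ← Real.cos_zero]
        exact Real.cos_lt_cos_of_nonneg_of_le_pi le_rfl
          (by linarith [hx.2, Real.pi_gt_three]) hx.1
      exact mul_ne_zero (by linarith) (Real.rpow_pos_of_pos hx.1 _).ne'
  · refine (ae_restrict_iff' measurableSet_Ioi).2 (Eventually.of_forall fun x hx => ?_)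
    exact mul_nonneg (by linarith [Real.cos_le_one (1 * x)]) (Real.rpow_nonneg (le_of_lt hx) _)

theorem covKernel_nonneg {H : ℝ} (h0 : 0 < H) (h1 : H < 1) {ι : Type*} (S : Finset ι)
    (τ : ι → ℝ) (hτ : ∀ i, 0 ≤ τ i) (a : ι → ℝ) :
    0 ≤ ∑ i ∈ S, ∑ j ∈ S, a i * a j * covKernel H (τ i) (τ j) := by
  set C := ∫ x in Set.Ioi (0 : ℝ), (1 - Real.cos (1 * x)) * x ^ (-1 - 2 * H) with hC
  have hCpos : 0 < C := integral_one_sub_cos_pos h0 h1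
  let g : ℝ → ℝ → ℝ := fun t x => (1 - Real.cos (t * x)) * x ^ (-1 - 2 * H)
  have hg : ∀ t, IntegrableOn (g t) (Set.Ioi 0) := integrableOn_one_sub_cos h0 h1
  have hgi : ∀ t, ∫ x in Set.Ioi (0 : ℝ), g t x = |t| ^ (2 * H) * C := integral_one_sub_cos h0
  have e : 2 * C * ∑ i ∈ S, ∑ j ∈ S, a i * a j * covKernel H (τ i) (τ j) =
      ∫ x in Set.Ioi (0 : ℝ), ∑ i ∈ S, ∑ j ∈ S,
        a i * a j * (g (τ j) x + g (τ i) x - g (τ j - τ i) x) := by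
    have hij : ∀ i j, IntegrableOn
        (fun x => a i * a j * (g (τ j) x + g (τ i) x - g (τ j - τ i) x)) (Set.Ioi 0) :=
      fun i j => (((hg _).add (hg _)).sub (hg _)).const_mul _
    rw [integral_finsetSum _ fun i _ => integrable_finsetSum _ fun j _ => hij i j, Finset.mul_sum]
    refine Finset.sum_congr rfl fun i _ => ?_
    rw [integral_finsetSum _ fun j _ => hij i j, Finset.mul_sum]
    refine Finset.sum_congr rfl fun j _ => ?_
    have hadd : IntegrableOn (fun x => g (τ j) x + g (τ i) x) (Set.Ioi 0) := (hg _).add (hg _)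
    rw [integral_const_mul, integral_sub hadd (hg _), integral_add (hg _) (hg _), hgi, hgi, hgi, abs_of_nonneg (hτ i), abs_of_nonneg (hτ j),
      covKernel]
    ring
  have e2 : 0 ≤ 2 * C * ∑ i ∈ S, ∑ j ∈ S, a i * a j * covKernel H (τ i) (τ j) := by
    rw [e]
    refine setIntegral_nonneg measurableSet_Ioi fun x hx => ?_
    have : ∑ i ∈ S, ∑ j ∈ S, a i * a j * (g (τ j) x + g (τ i) x - g (τ j - τ i) x) =
        ((∑ i ∈ S, a i * (1 - Real.cos (τ i * x))) ^ 2 + (∑ i ∈ S, a i * Real.sin (τ i * x)) ^ 2) *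
          x ^ (-1 - 2 * H) := by
      rw [sq, sq, Finset.sum_mul_sum, Finset.sum_mul_sum, ← Finset.sum_add_distrib,
        Finset.sum_mul]
      refine Finset.sum_congr rfl fun i _ => ?_
      rw [← Finset.sum_add_distrib, Finset.sum_mul]
      refine Finset.sum_congr rfl fun j _ => ?_
      simp only [g, sub_mul (τ j), Real.cos_sub]
      ring
    rw [this]
    exact mul_nonneg (by positivity) (Real.rpow_nonneg (le_of_lt hx) _)
  exact nonneg_of_mul_nonneg_right e2 (by positivity)


/-- The space of step functions on `[0, T]`. The functions `1_{[0,t]}`, `t ∈ [0, T]`, are linearly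
independent, so their span is presented here through this basis: `Finsupp.single t 1` is
`1_{[0,t]}`. It carries the inner product `⟨1_{[0,t]}, 1_{[0,s]}⟩ = covKernel H s t`. -/
def StepFn (_H : Set.Ioo (0 : ℝ) 1) (T : ℝ) : Type := Set.Icc (0 : ℝ) T →₀ ℝ

namespace StepFn

variable (H : Set.Ioo (0 : ℝ) 1) (T : ℝ)

instance : AddCommGroup (StepFn H T) := inferInstanceAs (AddCommGroup (Set.Icc (0 : ℝ) T →₀ ℝ))

instance : Module ℝ (StepFn H T) := inferInstanceAs (Module ℝ (Set.Icc (0 : ℝ) T →₀ ℝ))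

/-- The bilinear extension of `covKernel` to step functions. -/
def innerStep (f g : Set.Icc (0 : ℝ) T →₀ ℝ) : ℝ :=
  f.sum fun s a => g.sum fun t b => a * b * covKernel H s t

/-- The semi-inner product on step functions. -/
@[reducible] def core : PreInnerProductSpace.Core ℝ (StepFn H T) where
  inner f g := innerStep H T f g
  conj_inner_symm f g := by
    simp only [innerStep, conj_trivial, Finsupp.sum]
    rw [Finset.sum_comm]
    refine Finset.sum_congr rfl fun s _ => Finset.sum_congr rfl fun t _ => ?_
    rw [covKernel_symm]
    ring
  re_inner_nonneg f := by
    have := covKernel_nonneg H.2.1 H.2.2 (Finsupp.support f) (fun i => (i : ℝ))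
      (fun i => i.2.1) (fun i => (show Set.Icc (0 : ℝ) T →₀ ℝ from f) i)
    exact this
  add_left f g h := by
    refine Finsupp.sum_add_index' (fun s => ?_) (fun s a b => ?_)
    · simp [Finsupp.sum]
    · simp [Finsupp.sum, ← Finset.sum_add_distrib, add_mul]
  smul_left f g r := by
    refine (Finsupp.sum_smul_index' (fun s => ?_)).trans ?_
    · simp [Finsupp.sum]
    · simp only [innerStep, Finsupp.sum, Finset.mul_sum, smul_eq_mul, conj_trivial]
      refine Finset.sum_congr rfl fun s _ => Finset.sum_congr rfl fun t _ => ?_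
      ring

instance : SeminormedAddCommGroup (StepFn H T) :=
  @InnerProductSpace.Core.toSeminormedAddCommGroup ℝ (StepFn H T) _ _ _ (core H T)

instance : InnerProductSpace ℝ (StepFn H T) := InnerProductSpace.ofCore (core H T)

end StepFn

/-- The Hilbert space `𝔥`: the completion of the step functions. -/
abbrev CMSpace (H : Set.Ioo (0 : ℝ) 1) (T : ℝ) : Type := UniformSpace.Completion (StepFn H T)

/-- The step function `1_{[0,t]}`, for `t ∈ [0, T]`. -/
def StepFn.basisFn (H : Set.Ioo (0 : ℝ) 1) (T : ℝ) (t : Set.Icc (0 : ℝ) T) : StepFn H T :=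
  (Finsupp.single t (1 : ℝ) : Set.Icc (0 : ℝ) T →₀ ℝ)

open Classical in
/-- The step function `1_{[0,t]}`, for a real number `t` (used for `t ∈ [0, T]` only). -/
def indStep (H : Set.Ioo (0 : ℝ) 1) (T t : ℝ) : StepFn H T :=
  if h : t ∈ Set.Icc (0 : ℝ) T then StepFn.basisFn H T ⟨t, h⟩ else 0

/-- `1_{[0,t]}` as an element of `𝔥`, for `t ∈ [0, T]`. -/
def ind (H : Set.Ioo (0 : ℝ) 1) (T t : ℝ) : CMSpace H T :=
  ((indStep H T t : StepFn H T) : UniformSpace.Completion (StepFn H T))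

theorem inner_ind (H : Set.Ioo (0 : ℝ) 1) {T s t : ℝ} (hs : s ∈ Set.Icc 0 T)
    (ht : t ∈ Set.Icc 0 T) : ⟪ind H T t, ind H T s⟫_ℝ = covKernel H s t := by
  rw [real_inner_comm, ind, ind, UniformSpace.Completion.inner_coe, indStep, indStep, dif_pos hs,
    dif_pos ht]
  change StepFn.innerStep H T (Finsupp.single _ _) (Finsupp.single _ _) = _
  simp [StepFn.innerStep]

section Isonormal

variable {𝔥 Ω : Type*} [NormedAddCommGroup 𝔥] [InnerProductSpace ℝ 𝔥] {mΩ : MeasurableSpace Ω}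

/-- An isonormal Gaussian process over the Hilbert space `𝔥`. -/
structure IsIsonormal (W : 𝔥 → Ω → ℝ) (P : Measure Ω) : Prop where
  isGaussianProcess : IsGaussianProcess W P
  mean_zero : ∀ h, ∫ ω, W h ω ∂P = 0
  covariance : ∀ g h, ∫ ω, W g ω * W h ω ∂P = ⟪g, h⟫_ℝ

namespace IsIsonormal

variable {W : 𝔥 → Ω → ℝ} {P : Measure Ω}

theorem memLp (hW : IsIsonormal W P) (h : 𝔥) : MemLp (W h) 2 P :=
  (hW.isGaussianProcess.hasGaussianLaw_eval h).memLp_two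

theorem ae_eq_smul_add (hW : IsIsonormal W P) (c : ℝ) (g h : 𝔥) :
    W (c • g + h) =ᵐ[P] fun ω => c * W g ω + W h ω := by
  have i : ∀ a b, Integrable (fun ω => W a ω * W b ω) P := fun a b =>
    (hW.memLp a).integrable_mul (hW.memLp b)
  have hmem : MemLp (fun ω => W (c • g + h) ω - (c * W g ω + W h ω)) 2 P :=
    (hW.memLp _).sub (((hW.memLp g).const_mul c).add (hW.memLp h))
  set k := c • g + h with hk
  have e : ∀ ω, (W k ω - (c * W g ω + W h ω)) ^ 2 =
      W k ω * W k ω + c ^ 2 * (W g ω * W g ω) + W h ω * W h ω - 2 * c * (W k ω * W g ω)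
        - 2 * (W k ω * W h ω) + 2 * c * (W g ω * W h ω) := fun ω => by ring
  have h0 : ∫ ω, (W k ω - (c * W g ω + W h ω)) ^ 2 ∂P = 0 := by
    simp_rw [e]
    rw [integral_add, integral_sub, integral_sub, integral_add, integral_add, integral_const_mul,
      integral_const_mul, integral_const_mul, integral_const_mul]
    · simp only [hW.covariance, hk, inner_add_left, inner_add_right, real_inner_smul_left,
        real_inner_smul_right, real_inner_comm g h]
      ring
    all_goals
      first
      | exact i _ _
      | exact (i _ _).const_mul _
      | fun_prop (disch := assumption)
  have h1 := (integral_eq_zero_iff_of_nonneg (fun ω => sq_nonneg _) hmem.integrable_sq).1 h0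
  filter_upwards [h1] with ω hω
  have : W k ω - (c * W g ω + W h ω) = 0 := by simpa using hω
  linarith

theorem aestronglyMeasurable_wick (hW : IsIsonormal W P) (g h : 𝔥) :
    AEStronglyMeasurable (fun ω => W g ω * W h ω - ⟪g, h⟫_ℝ) P :=
  ((hW.memLp g).aestronglyMeasurable.mul (hW.memLp h).aestronglyMeasurable).sub
    aestronglyMeasurable_const

/-- The random variable `W(g) W(h) - ⟨g, h⟩`, modulo almost sure equality. -/
def wick (hW : IsIsonormal W P) (g h : 𝔥) : Ω →ₘ[P] ℝ :=
  AEEqFun.mk (fun ω => W g ω * W h ω - ⟪g, h⟫_ℝ) (hW.aestronglyMeasurable_wick g h)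

theorem wick_symm (hW : IsIsonormal W P) (g h : 𝔥) : hW.wick g h = hW.wick h g := by
  rw [wick, wick, AEEqFun.mk_eq_mk]
  exact Eventually.of_forall fun ω => by simp only [real_inner_comm, mul_comm]

theorem wick_add (hW : IsIsonormal W P) (g g' h : 𝔥) :
    hW.wick (g + g') h = hW.wick g h + hW.wick g' h := by
  rw [wick, wick, wick, AEEqFun.mk_add_mk, AEEqFun.mk_eq_mk]
  filter_upwards [hW.ae_eq_smul_add 1 g g'] with ω h1
  rw [one_smul, one_mul] at h1
  simp only [Pi.add_apply, h1, inner_add_left]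
  ring

theorem wick_smul (hW : IsIsonormal W P) (c : ℝ) (g h : 𝔥) :
    hW.wick (c • g) h = c • hW.wick g h := by
  rw [wick, wick, AEEqFun.smul_mk, AEEqFun.mk_eq_mk]
  filter_upwards [hW.ae_eq_smul_add c g 0, hW.ae_eq_smul_add 1 0 0] with ω h1 h2
  simp only [smul_zero, add_zero, one_mul] at h1 h2
  have h3 : W 0 ω = 0 := by linarith
  simp only [Pi.smul_apply, smul_eq_mul, h1, h3, real_inner_smul_left]
  ring

/-- The double Wiener integral, on the algebraic tensor product (which contains all the kernels
used below): the linear map with `I₂(g ⊗ h) = W(g) W(h) - ⟨g, h⟩`; it depends on the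
symmetrization of the kernel only, and `I₂(h ⊗ h) = W(h)² - ‖h‖²`. -/
def I₂ (hW : IsIsonormal W P) : 𝔥 ⊗[ℝ] 𝔥 →ₗ[ℝ] (Ω →ₘ[P] ℝ) :=
  TensorProduct.lift (LinearMap.mk₂ ℝ hW.wick hW.wick_add hW.wick_smul
    (fun g h h' => by
      rw [hW.wick_symm, hW.wick_add, hW.wick_symm h, hW.wick_symm h'])
    (fun c g h => by rw [hW.wick_symm, hW.wick_smul, hW.wick_symm h]))

end IsIsonormal

/-- The contraction `⊗₁`, with `(a ⊗ b) ⊗₁ (c ⊗ d) = ⟨a, c⟩ b ⊗ d`. -/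
def contr₁ (f g : 𝔥 ⊗[ℝ] 𝔥) : 𝔥 ⊗[ℝ] 𝔥 :=
  TensorProduct.lid ℝ (𝔥 ⊗[ℝ] 𝔥)
    (TensorProduct.map (TensorProduct.lift (innerₗ 𝔥)) LinearMap.id
      (TensorProduct.tensorTensorTensorComm ℝ 𝔥 𝔥 𝔥 𝔥 (f ⊗ₜ g)))

/-- The symmetrized contraction `⊙₁`. -/
def symContr₁ (f g : 𝔥 ⊗[ℝ] 𝔥) : 𝔥 ⊗[ℝ] 𝔥 :=
  (1 / 2 : ℝ) • (contr₁ f g + TensorProduct.comm ℝ 𝔥 𝔥 (contr₁ f g))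

end Isonormal

section Model

/-- The sampling point `t_x^m = x T / m`. -/
def grid (T : ℝ) (m : ℕ) (x : ℝ) : ℝ := x * T / m

/-- `1_{j+1}^m - 1_j^m`, where `1_j^m` is the indicator function of `(t_{j-1}^m, t_j^m]`. -/
def stepDiff (H : Set.Ioo (0 : ℝ) 1) (T : ℝ) (m j : ℕ) : CMSpace H T :=
  (ind H T (grid T m (j + 1)) - ind H T (grid T m j))
    - (ind H T (grid T m j) - ind H T (grid T m (j - 1)))

variable {H : Set.Ioo (0 : ℝ) 1} {T : ℝ} {Ω : Type*} {mΩ : MeasurableSpace Ω}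

/-- The fractional Brownian motion `B_t = W(1_{[0,t]})`, `t ∈ [0, T]`. -/
def fBM (W : CMSpace H T → Ω → ℝ) (t : ℝ) (ω : Ω) : ℝ := W (ind H T t) ω

/-- The second order difference `d_{n,j} = B_{t_{j+1}} - 2 B_{t_j} + B_{t_{j-1}}`. -/
def secondDiff (W : CMSpace H T → Ω → ℝ) (n j : ℕ) (ω : Ω) : ℝ :=
  fBM W (grid T n (j + 1)) ω - 2 * fBM W (grid T n j) ω + fBM W (grid T n (j - 1)) ω

/-- The sum of squares `V_{n,T}^{(2)} = ∑_{j=1}^{n-1} d_{n,j}²`. -/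
def V₂ (W : CMSpace H T → Ω → ℝ) (n : ℕ) (ω : Ω) : ℝ :=
  ∑ j ∈ Finset.Ico 1 n, secondDiff W n j ω ^ 2

/-- The expectation of `V_{n,T}^{(2)}`. -/
def meanV₂ (W : CMSpace H T → Ω → ℝ) (P : Measure Ω) (n : ℕ) : ℝ := ∫ ω, V₂ W n ω ∂P

/-- `M_n = -√n {(V_{2n,T} / E[V_{2n,T}] - 1) - (V_{n,T} / E[V_{n,T}] - 1)}`. -/
def M (W : CMSpace H T → Ω → ℝ) (P : Measure Ω) (n : ℕ) (ω : Ω) : ℝ :=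
  -√n * ((V₂ W (2 * n) ω / meanV₂ W P (2 * n) - 1) - (V₂ W n ω / meanV₂ W P n - 1))

/-- The kernel `f_n^{[α]} = √n ∑_{j=1}^{αn-1} (1_{j+1}^{αn} - 1_j^{αn})^{⊗2} / E[V_{αn,T}]`. -/
def kern (W : CMSpace H T → Ω → ℝ) (P : Measure Ω) (α n : ℕ) : CMSpace H T ⊗[ℝ] CMSpace H T :=
  (√n / meanV₂ W P (α * n)) •
    ∑ j ∈ Finset.Ico 1 (α * n), stepDiff H T (α * n) j ⊗ₜ[ℝ] stepDiff H T (α * n) j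

/-- `G̃_n = 2 I₂(f_n^{[2]} ⊗₁ f_n^{[2]}) - 4 I₂(f_n^{[2]} ⊙₁ f_n^{[1]})
+ 2 I₂(f_n^{[1]} ⊗₁ f_n^{[1]})`. -/
def Gtilde {W : CMSpace H T → Ω → ℝ} {P : Measure Ω} (hW : IsIsonormal W P) (n : ℕ) :
    Ω →ₘ[P] ℝ :=
  (2 : ℝ) • hW.I₂ (contr₁ (kern W P 2 n) (kern W P 2 n))
    - (4 : ℝ) • hW.I₂ (symContr₁ (kern W P 2 n) (kern W P 1 n))
    + (2 : ℝ) • hW.I₂ (contr₁ (kern W P 1 n) (kern W P 1 n))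

end Model

section Constants

variable (H : ℝ)

/-- The correlation function `ρ̂`. -/
def rhoHat (j : ℤ) : ℝ :=
  1 / 2 * (-|(j : ℝ) - 2| ^ (2 * H) + 4 * |(j : ℝ) - 1| ^ (2 * H) - 6 * |(j : ℝ)| ^ (2 * H)
    + 4 * |(j : ℝ) + 1| ^ (2 * H) - |(j : ℝ) + 2| ^ (2 * H))

/-- The correlation function `ρ̃`. -/
def rhoTilde (j : ℤ) : ℝ :=
  1 / 2 ^ (2 * H + 1) * (-|(j : ℝ) - 3| ^ (2 * H) + 2 * |(j : ℝ) - 2| ^ (2 * H)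
    + |(j : ℝ) - 1| ^ (2 * H) - 4 * |(j : ℝ)| ^ (2 * H) + |(j : ℝ) + 1| ^ (2 * H)
    + 2 * |(j : ℝ) + 2| ^ (2 * H) - |(j : ℝ) + 3| ^ (2 * H))

/-- The constant `4 - 2^{2H}`. -/
def cH : ℝ := 4 - 2 ^ (2 * H)

/-- The general term of the series in `Σ₁₁`, indexed by `i = k + 1 ≥ 1`. -/
def term11 (k : ℕ) : ℝ := rhoHat H (k + 1) ^ 2

/-- The general term of the series in `Σ₁₂`. -/
def term12 (l : ℤ) : ℝ := rhoTilde H l ^ 2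

/-- The constant `Σ₁₁`. -/
def Sigma11 : ℝ := 2 * (1 + 2 / cH H ^ 2 * ∑' k, term11 H k)

/-- The constant `Σ₂₂`. -/
def Sigma22 : ℝ := 1 / 2 * Sigma11 H

/-- The constant `Σ₁₂`. -/
def Sigma12 : ℝ := 2 ^ (2 * H) / cH H ^ 2 * ∑' l, term12 H l

/-- The constant `G_∞`. -/
def Ginf : ℝ := Sigma22 H - 2 * Sigma12 H + Sigma11 H

/-- The general term of the series in `κ(1;1,1)`. -/
def term1_11 (i : ℤ × ℤ) : ℝ := rhoHat H i.1 * rhoHat H (i.1 - i.2) * rhoHat H i.2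

/-- The general term of the series in `κ(2;1,1)`. -/
def term2_11 (i : ℤ × ℤ) : ℝ := rhoHat H i.1 * rhoTilde H (i.2 - 2 * i.1) * rhoTilde H i.2

/-- The general term of the series in `κ(1;2,2)`. -/
def term1_22 (i : ℤ × ℤ) : ℝ := rhoHat H i.1 * rhoTilde H (i.1 - i.2) * rhoTilde H i.2

/-- The general term of the series in `κ(1,1;1,1)`. -/
def term11_11 (i : ℤ × ℤ × ℤ) : ℝ :=
  rhoHat H i.1 * rhoHat H (i.1 - i.2.1) * rhoHat H (i.2.1 - i.2.2) * rhoHat H i.2.2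

/-- The general term of the series in `κ(1,1;2,2)`. -/
def term11_22 (i : ℤ × ℤ × ℤ) : ℝ :=
  rhoTilde H (2 * i.1) * rhoHat H (i.1 - i.2.1) * rhoTilde H (2 * i.2.1 - i.2.2) * rhoHat H i.2.2
    + rhoTilde H (2 * i.1 + 1) * rhoHat H (i.1 - i.2.1) * rhoTilde H (2 * i.2.1 - i.2.2 + 1)
      * rhoHat H i.2.2

/-- The general term of the series in `κ(1,1;1,2)`. -/
def term11_12 (i : ℤ × ℤ × ℤ) : ℝ :=
  rhoHat H i.1 * rhoTilde H (2 * i.1 - i.2.1) * rhoTilde H (i.2.1 - 2 * i.2.2) * rhoHat H i.2.2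

/-- The general term of the series in `κ(1,2;2,2)`. -/
def term12_22 (i : ℤ × ℤ × ℤ) : ℝ :=
  rhoHat H i.1 * rhoHat H (i.1 - i.2.1) * rhoTilde H (i.2.1 - i.2.2) * rhoTilde H i.2.2

/-- The general term of the series in `κ(1,2;1,2)₁`. -/
def term12_12a (i : ℤ × ℤ × ℤ) : ℝ :=
  rhoHat H i.1 * rhoTilde H (2 * i.1 - i.2.1) * rhoHat H (i.2.1 - i.2.2) * rhoTilde H i.2.2

/-- The general term of the first series in `κ(1,2;1,2)₂`. -/
def term12_12b (i : ℤ × ℤ × ℤ) : ℝ :=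
  rhoTilde H (2 * i.1) * rhoTilde H (2 * i.1 - i.2.1) * rhoTilde H (i.2.1 - 2 * i.2.2)
    * rhoTilde H (2 * i.2.2)

/-- The general term of the second series in `κ(1,2;1,2)₂`. -/
def term12_12c (i : ℤ × ℤ × ℤ) : ℝ :=
  rhoTilde H (2 * i.1 + 1) * rhoTilde H (2 * i.1 - i.2.1) * rhoTilde H (i.2.1 - 2 * i.2.2)
    * rhoTilde H (2 * i.2.2 + 1)

/-- All the series that define the constants converge absolutely. -/
def SeriesConverge : Prop :=
  Summable (term11 H) ∧ Summable (term12 H) ∧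
  Summable (term1_11 H) ∧ Summable (term2_11 H) ∧ Summable (term1_22 H) ∧
  Summable (term11_11 H) ∧ Summable (term11_22 H) ∧ Summable (term11_12 H) ∧
  Summable (term12_22 H) ∧
  Summable (term12_12a H) ∧ Summable (term12_12b H) ∧ Summable (term12_12c H)

/-- The constant `κ(1;1,1)`. -/
def kappa1_11 : ℝ := 1 / cH H ^ 3 * ∑' i, term1_11 H i

/-- The constant `κ(2;1,1)`. -/
def kappa2_11 : ℝ := 2 ^ (2 * H - 1) / cH H ^ 3 * ∑' i, term2_11 H i

/-- The constant `κ(1;2,2)`. -/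
def kappa1_22 : ℝ := 2 ^ (2 * H - 2) / cH H ^ 3 * ∑' i, term1_22 H i

/-- The constant `κ(2;2,2)`; the factor comes from `f_n^{[2]} = 2^{-1/2} f_{2n}^{[1]}`. -/
def kappa2_22 : ℝ := 1 / 4 * kappa1_11 H

/-- The constant `κ(1;1,2)`, which is `κ(2;1,1)`. -/
def kappa1_12 : ℝ := kappa2_11 H

/-- The constant `κ(2;1,2)`, which is `κ(1;2,2)`. -/
def kappa2_12 : ℝ := kappa1_22 H

/-- The constant `κ(1,1;1,1)`. -/
def kappa11_11 : ℝ := 1 / cH H ^ 4 * ∑' i, term11_11 H i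

/-- The constant `κ(2,2;2,2)`; the factor comes from `f_n^{[2]} = 2^{-1/2} f_{2n}^{[1]}`. -/
def kappa22_22 : ℝ := 1 / 8 * kappa11_11 H

/-- The constant `κ(1,1;2,2)`. -/
def kappa11_22 : ℝ := 2 ^ (2 * H - 2) / cH H ^ 4 * ∑' i, term11_22 H i

/-- The constant `κ(1,1;1,2)`. -/
def kappa11_12 : ℝ := 2 ^ (2 * H - 1) / cH H ^ 4 * ∑' i, term11_12 H i

/-- The constant `κ(1,2;2,2)`. -/
def kappa12_22 : ℝ := 2 ^ (2 * H - 3) / cH H ^ 4 * ∑' i, term12_22 H i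

/-- The constant `κ(1,2;1,2) = κ(1,2;1,2)₁ + κ(1,2;1,2)₂`. -/
def kappa12_12 : ℝ :=
  2 ^ (2 * H - 3) / cH H ^ 4 * ∑' i, term12_12a H i
    + 2 ^ (4 * H - 3) / cH H ^ 4 * (∑' i, term12_12b H i + ∑' i, term12_12c H i)

/-- The entry `𝔘₁₃`. -/
def U13 : ℝ := 4 * kappa1_22 H - 8 * kappa1_12 H + 4 * kappa1_11 H

/-- The entry `𝔘₂₃`. -/
def U23 : ℝ := 4 * kappa2_22 H - 8 * kappa2_12 H + 4 * kappa2_11 H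

/-- The entry `𝔘₃₃`. -/
def U33 : ℝ :=
  8 * kappa22_22 H + 32 * kappa12_12 H + 8 * kappa11_11 H
    - 32 * kappa12_22 H + 16 * kappa11_22 H - 32 * kappa11_12 H

/-- The symmetric matrix `𝔘`. -/
def matU : Matrix (Fin 3) (Fin 3) ℝ :=
  !![Sigma11 H, Sigma12 H, U13 H;
     Sigma12 H, Sigma22 H, U23 H;
     U13 H, U23 H, U33 H]

/-- The symmetric matrix `𝔗`. -/
def matT : Matrix (Fin 2) (Fin 2) ℝ :=
  !![matU H 0 0 - 2 * matU H 0 1 + matU H 1 1, matU H 0 2 - matU H 1 2;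
     matU H 0 2 - matU H 1 2, matU H 2 2]

end Constants

end

end FracBM

/-!
`M_n` is the double Wiener integral `I₂(A_n)` of the symmetric kernel `A_n = f_n^{[1]} - f_n^{[2]}`,
and `G̃_n = 2 I₂(A_n ⊗₁ A_n)`. A symmetric kernel of finite rank is diagonal in an orthonormal
family `(e_k)`, with eigenvalues `a_k`, and its contraction is diagonal in the same family with
eigenvalues `a_k²`. So `(M_n, √n G̃_n)` is a weighted sum of the independent variables
`W(e_k)² - 1`, and the classical central limit theorem for such sums applies: it suffices that
`max_k |a_k| = O(n^{-1/2})` and that the covariances converge.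

By self-similarity of fractional Brownian motion, the Gram matrices of the second differences on the
grids of size `n` and `2n` are Toeplitz with entries `ρ̂` and `ρ̃`, up to scaling. The absolute
summability of `ρ̂` bounds the eigenvalues (Schur's test), and it identifies the limits of the
covariances, which are averages of translates of one absolutely convergent multiple series, as the
entries of `𝔗`. In particular `𝔗` is a limit of Gram matrices, hence positive semidefinite, and the
nonnegativity of the limit of `‖D_n - (√2/2) D_{2n}‖² / n` for the kernels `D_n` of the quadratic
variation gives `√2 Σ₁₂ ≤ Σ₁₁`.
-/

open scoped Topology

namespace FracBM

section WeightedSums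

theorem charFun_sub_charFun_isLittleO {μ ν : Measure ℝ} [IsFiniteMeasure μ] [IsFiniteMeasure ν]
    {n : ℕ} (hμ : MemLp id n μ) (hν : MemLp id n ν)
    (hmoments : ∀ k ≤ n, ∫ x, x ^ k ∂μ = ∫ x, x ^ k ∂ν) :
    (fun t => charFun μ t - charFun ν t) =o[𝓝 0] fun t => t ^ n := by
  have hTaylor : taylorWithinEval (charFun μ) n Set.univ 0 =
      taylorWithinEval (charFun ν) n Set.univ 0 := by
    funext t
    rw [taylorWithinEval_charFun_zero hμ, taylorWithinEval_charFun_zero hν]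
    refine Finset.sum_congr rfl fun k hk => ?_
    rw [hmoments k (Finset.mem_range_succ_iff.1 hk)]
  have h := (taylor_isLittleO_univ (x₀ := 0) (contDiff_charFun hμ)).sub
    (taylor_isLittleO_univ (x₀ := 0) (contDiff_charFun hν))
  simpa only [hTaylor, sub_sub_sub_cancel_right, sub_zero] using h

theorem norm_prod_sub_prod_le {ι : Type*} (s : Finset ι) {a b : ι → ℂ} (ha : ∀ i ∈ s, ‖a i‖ ≤ 1)
    (hb : ∀ i ∈ s, ‖b i‖ ≤ 1) : ‖∏ i ∈ s, a i - ∏ i ∈ s, b i‖ ≤ ∑ i ∈ s, ‖a i - b i‖ := by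
  classical
  induction s using Finset.induction_on with
  | empty => simp
  | insert i s hi ih =>
    simp only [Finset.forall_mem_insert] at ha hb
    rw [Finset.prod_insert hi, Finset.prod_insert hi, Finset.sum_insert hi]
    have hprod : ‖∏ j ∈ s, a j‖ ≤ 1 := by
      rw [norm_prod]
      exact Finset.prod_le_one (fun _ _ => norm_nonneg _) ha.2
    calc _ = ‖(a i - b i) * ∏ j ∈ s, a j + b i * (∏ j ∈ s, a j - ∏ j ∈ s, b j)‖ := by
          congr 1; ring
      _ ≤ ‖a i - b i‖ * ‖∏ j ∈ s, a j‖ + ‖b i‖ * ‖∏ j ∈ s, a j - ∏ j ∈ s, b j‖ := by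
          rw [← norm_mul, ← norm_mul]
          exact norm_add_le _ _
      _ ≤ _ := add_le_add (mul_le_of_le_one_right (norm_nonneg _) hprod)
          ((mul_le_of_le_one_left (norm_nonneg _) hb.1).trans (ih ha.2 hb.2))

theorem tendsto_prod_sub_prod_charFun {μ ν : Measure ℝ} [IsProbabilityMeasure μ]
    [IsProbabilityMeasure ν] {p : ℕ}
    (hμν : (fun t => charFun μ t - charFun ν t) =o[𝓝 0] fun t => t ^ p)
    {ι : ℕ → Type*} [∀ n, Fintype (ι n)] {w : ∀ n, ι n → ℝ} {r : ℕ → ℝ}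
    (hr : Tendsto r atTop (𝓝 0)) (hw : ∀ᶠ n in atTop, ∀ i, |w n i| ≤ r n)
    {C : ℝ} (hC : ∀ᶠ n in atTop, ∑ i, |w n i| ^ p ≤ C) :
    Tendsto (fun n => ∏ i, charFun μ (w n i) - ∏ i, charFun ν (w n i)) atTop (𝓝 0) := by
  rw [Metric.tendsto_nhds]
  intro ε hε
  obtain ⟨η, hη, hηC⟩ : ∃ η, 0 < η ∧ η * |C| < ε :=
    ⟨ε / (|C| + 1), by positivity, by
      rw [div_mul_eq_mul_div, div_lt_iff₀ (by positivity)]; nlinarith⟩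
  obtain ⟨δ, hδ, hlocal⟩ := Metric.eventually_nhds_iff.1 (hμν.bound hη)
  filter_upwards [hw, hr.eventually (gt_mem_nhds hδ), hC] with n hwn hrn hCn
  rw [dist_zero_right]
  calc _ ≤ ∑ i, ‖charFun μ (w n i) - charFun ν (w n i)‖ :=
        norm_prod_sub_prod_le _ (fun _ _ => norm_charFun_le_one _)
          fun _ _ => norm_charFun_le_one _
    _ ≤ ∑ i, η * |w n i| ^ p := Finset.sum_le_sum fun i _ => by
        simpa using hlocal (y := w n i) (by simpa using (hwn i).trans_lt hrn)
    _ ≤ η * |C| := by rw [← Finset.mul_sum]; gcongr; exact hCn.trans (le_abs_self C)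
    _ < ε := hηC

theorem integral_sq_gaussianReal (v : NNReal) : ∫ x, x ^ 2 ∂gaussianReal 0 v = v := by
  have h := variance_fun_id_gaussianReal (μ := 0) (v := v)
  rw [variance_eq_integral (by fun_prop)] at h
  simpa [integral_id_gaussianReal] using h

/-- Lindeberg's method: each factor is exchanged for the Gaussian one with the same first two
moments. -/
theorem tendsto_prod_charFun {ν : Measure ℝ} [IsProbabilityMeasure ν] (hν : MemLp id 2 ν)
    (hmean : ∫ x, x ∂ν = 0) {v : NNReal} (hvar : ∫ x, x ^ 2 ∂ν = v)
    {ι : ℕ → Type*} [∀ n, Fintype (ι n)] {w : ∀ n, ι n → ℝ} {r : ℕ → ℝ}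
    (hr : Tendsto r atTop (𝓝 0)) (hw : ∀ᶠ n in atTop, ∀ i, |w n i| ≤ r n) {s : ℝ}
    (hs : Tendsto (fun n => ∑ i, w n i ^ 2) atTop (𝓝 s)) :
    Tendsto (fun n => ∏ i, charFun ν (w n i)) atTop (𝓝 (Complex.exp (-(v * s / 2 : ℝ)))) := by
  have hgauss : ∀ n, ∏ i, charFun (gaussianReal 0 v) (w n i) =
      Complex.exp (-(v * (∑ i, w n i ^ 2) / 2 : ℝ)) := fun n => by
    simp only [charFun_gaussianReal, ← Complex.exp_sum]
    push_cast
    simp [Finset.mul_sum, Finset.sum_div]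
  have hmoments : ∀ k ≤ 2, ∫ x, x ^ k ∂ν = ∫ x, x ^ k ∂gaussianReal 0 v := by
    intro k hk
    interval_cases k
    · simp
    · simp [hmean]
    · rw [hvar, integral_sq_gaussianReal]
  have hdiff := tendsto_prod_sub_prod_charFun
    (charFun_sub_charFun_isLittleO (n := 2) (mod_cast hν) (memLp_id_gaussianReal 2) hmoments) hr hw
    (C := s + 1) (by simpa only [sq_abs] using hs.eventually (ge_mem_nhds (lt_add_one s)))
  have hlim : Tendsto (fun n => Complex.exp (-(v * (∑ i, w n i ^ 2) / 2 : ℝ))) atTop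
      (𝓝 (Complex.exp (-(v * s / 2 : ℝ)))) := by
    have hexponent := (hs.const_mul (v : ℝ)).div_const 2
    exact (Complex.continuous_exp.tendsto _).comp
      ((Complex.continuous_ofReal.tendsto _).comp hexponent).neg
  simpa [hgauss] using hdiff.add (hlim.congr fun n => (hgauss n).symm)

theorem integral_pow_four_gaussianReal (v : NNReal) :
    ∫ x, x ^ 4 ∂gaussianReal 0 v = 3 * v ^ 2 := by
  have hmgf := iteratedDeriv_mgf_zero (X := fun x : ℝ => x) (μ := gaussianReal 0 v) (by simp) 4
  simp only [mgf_fun_id_gaussianReal, zero_mul, zero_add, Pi.pow_apply] at hmgf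
  set g := fun t : ℝ => Real.exp (v * t ^ 2 / 2) with hg
  have hderiv : ∀ t, HasDerivAt g (v * t * g t) t := fun t => by
    convert! (((hasDerivAt_pow 2 t).const_mul (v : ℝ)).div_const 2).exp using 1
    simp only [hg]
    push_cast
    ring
  have hderiv_mul : ∀ p p' : ℝ → ℝ, (∀ t, HasDerivAt p (p' t) t) →
      deriv (fun t => p t * g t) = fun t => (p' t + v * t * p t) * g t := fun p p' hp => by
    funext t
    rw [((hp t).fun_mul (hderiv t)).deriv]
    ring
  have hderiv₁ : deriv g = fun t => v * t * g t := funext fun t => (hderiv t).deriv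
  rw [← hmgf, iteratedDeriv_succ', iteratedDeriv_succ', iteratedDeriv_succ', iteratedDeriv_one,
    hderiv₁, hderiv_mul _ (fun _ => v) fun t => by
      simpa using (hasDerivAt_id t).const_mul (v : ℝ),
    hderiv_mul _ (fun t => 2 * v ^ 2 * t) fun t => by
      convert! (hasDerivAt_const t (v : ℝ)).add
        ((hasDerivAt_id t).const_mul ((v : ℝ) ^ 2) |>.mul (hasDerivAt_id t)) using 1
      · funext; simp; ring
      · simp; ring,
    hderiv_mul _ (fun t => 3 * v ^ 2 + 3 * v ^ 3 * t ^ 2) fun t => by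
      convert! ((hasDerivAt_id t).const_mul (3 * (v : ℝ) ^ 2)).add
        ((hasDerivAt_pow 3 t).const_mul ((v : ℝ) ^ 3)) using 1
      · funext; simp; ring
      · simp; ring]
  simp [hg]

end WeightedSums

section CentralLimit

variable {Ω : Type*} {mΩ : MeasurableSpace Ω} {P : Measure Ω}

theorem tendstoInDistribution_congr' {α E Ω' : Type*} {_ : MeasurableSpace Ω'}
    {Q : Measure Ω'} [IsProbabilityMeasure P] [IsProbabilityMeasure Q] [TopologicalSpace E]
    [MeasurableSpace E] [OpensMeasurableSpace E] {l : Filter α} {X Y : α → Ω → E} {Z : Ω' → E}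
    (hXY : ∀ᶠ i in l, X i =ᵐ[P] Y i) (hY : ∀ i, AEMeasurable (Y i) P)
    (h : TendstoInDistribution X l Z (fun _ => P) Q) :
    TendstoInDistribution Y l Z (fun _ => P) Q where
  forall_aemeasurable := hY
  aemeasurable_limit := h.aemeasurable_limit
  tendsto := h.tendsto.congr' <| hXY.mono fun _ hi => Subtype.ext (Measure.map_congr hi)

theorem posSemidef_of_tendsto {n α : Type*} {l : Filter α} [l.NeBot]
    {A : α → Matrix n n ℝ} {S : Matrix n n ℝ} (hA : ∀ᶠ i in l, (A i).PosSemidef)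
    (hS : Tendsto A l (𝓝 S)) : S.PosSemidef := by
  refine ⟨tendsto_nhds_unique (((continuous_id.matrix_conjTranspose.tendsto S).comp hS).congr'
    (hA.mono fun i hi => hi.1)) hS, fun x => ?_⟩
  have hcont : Continuous fun B : Matrix n n ℝ =>
      x.sum fun i xi => x.sum fun j xj => star xi * B i j * xj := by
    unfold Finsupp.sum
    fun_prop
  exact ge_of_tendsto ((hcont.tendsto S).comp hS) (hA.mono fun i hi => hi.2 x)

theorem posSemidef_of_tendsto_inner {n α E : Type*} [Finite n] [NormedAddCommGroup E]
    [InnerProductSpace ℝ E] {l : Filter α} [l.NeBot] {x : α → n → E} {S : Matrix n n ℝ}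
    (hS : ∀ i j, Tendsto (fun a => ⟪x a i, x a j⟫_ℝ) l (𝓝 (S i j))) : S.PosSemidef :=
  posSemidef_of_tendsto (.of_forall fun a => Matrix.posSemidef_gram ℝ (x a))
    (tendsto_pi_nhds.2 fun i => tendsto_pi_nhds.2 fun j => hS i j)

theorem charFun_map_sum_smul {ι E : Type*} [Fintype ι] [NormedAddCommGroup E]
    [InnerProductSpace ℝ E] [MeasurableSpace E] [BorelSpace E] [SecondCountableTopology E]
    {Y : ι → Ω → ℝ} (hY : iIndepFun Y P) (hmeas : ∀ i, AEMeasurable (Y i) P) (a : ι → E) (t : E) :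
    charFun (P.map fun ω => ∑ i, Y i ω • a i) t = ∏ i, charFun (P.map (Y i)) ⟪a i, t⟫_ℝ := by
  have hindep : iIndepFun (fun i ω => Y i ω • a i) P :=
    hY.comp (fun i x => x • a i) fun i => by fun_prop
  rw [hindep.charFun_map_fun_sum_eq_prod fun i => (hmeas i).smul_const (a i), Finset.prod_apply]
  refine Finset.prod_congr rfl fun i _ => ?_
  rw [charFun_apply, charFun_apply, integral_map ((hmeas i).smul_const _) (by fun_prop),
    integral_map (hmeas i) (by fun_prop)]
  simp [real_inner_smul_left, mul_comm]

theorem tendstoInDistribution_sum_smul [IsProbabilityMeasure P] {ν : Measure ℝ}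
    [IsProbabilityMeasure ν] (hν : MemLp id 2 ν) (hmean : ∫ x, x ∂ν = 0) {v : NNReal}
    (hvar : ∫ x, x ^ 2 ∂ν = v) {ι : Type*} [Fintype ι] [DecidableEq ι] {κ : ℕ → Type*}
    [∀ n, Fintype (κ n)] {Y : ∀ n, κ n → Ω → ℝ} (hindep : ∀ n, iIndepFun (Y n) P)
    (hlaw : ∀ n k, HasLaw (Y n k) ν P) {a : ∀ n, κ n → EuclideanSpace ℝ ι}
    {S : Matrix ι ι ℝ}
    (hS : ∀ i j, Tendsto (fun n => ∑ k, a n k i * a n k j) atTop (𝓝 (S i j)))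
    {r : ℕ → ℝ} (hr : Tendsto r atTop (𝓝 0)) (ha : ∀ᶠ n in atTop, ∀ k, ‖a n k‖ ≤ r n) :
    TendstoInDistribution (fun n ω => ∑ k, Y n k ω • a n k) atTop id (fun _ => P)
      (multivariateGaussian 0 ((v : ℝ) • S)) := by
  let A : ℕ → Matrix ι ι ℝ := fun n => ∑ k, Matrix.vecMulVec (a n k).ofLp (a n k).ofLp
  have hA : Tendsto A atTop (𝓝 S) := by
    refine tendsto_pi_nhds.2 fun i => tendsto_pi_nhds.2 fun j => ?_
    simpa [A, Matrix.sum_apply, Matrix.vecMulVec_apply] using hS i j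
  have hpos : S.PosSemidef := posSemidef_of_tendsto (.of_forall fun n =>
    Matrix.posSemidef_sum _ fun k _ => Matrix.posSemidef_vecMulVec_self_star _) hA
  have hquad : ∀ (t : EuclideanSpace ℝ ι),
      Tendsto (fun n => ∑ k, ⟪a n k, t⟫_ℝ ^ 2) atTop (𝓝 (t.ofLp ⬝ᵥ S.mulVec t.ofLp)) := fun t => by
    refine ((Continuous.tendsto (f := fun B : Matrix ι ι ℝ => t.ofLp ⬝ᵥ B.mulVec t.ofLp)
      (by fun_prop) S).comp hA).congr fun n => ?_
    simp only [A, Function.comp_apply, Matrix.sum_mulVec, Matrix.vecMulVec_mulVec, dotProduct_smul,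
      dotProduct_sum, EuclideanSpace.inner_eq_star_dotProduct, star_trivial, sq,
      MulOpposite.smul_eq_mul_unop, MulOpposite.unop_op, dotProduct_comm]
  have hmeas : ∀ n k, AEMeasurable (Y n k) P := fun n k => (hlaw n k).aemeasurable
  refine ⟨fun n => Finset.aemeasurable_fun_sum _ fun k _ => (hmeas n k).smul_const _, by fun_prop,
    ProbabilityMeasure.tendsto_of_tendsto_charFun fun t => ?_⟩
  have hsmall : ∀ᶠ n in atTop, ∀ k, |⟪a n k, t⟫_ℝ| ≤ r n * ‖t‖ := ha.mono fun n hn k =>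
    (abs_real_inner_le_norm _ _).trans (by gcongr; exact hn k)
  have hpos_smul : ((v : ℝ) • S).PosSemidef := hpos.smul v.2
  have hlim := tendsto_prod_charFun hν hmean hvar (by simpa using hr.mul_const ‖t‖) hsmall (hquad t)
  simpa only [ProbabilityMeasure.coe_mk, Measure.map_id,
    charFun_multivariateGaussian hpos_smul, charFun_map_sum_smul (hindep _) (hmeas _),
    (hlaw _ _).map_eq, inner_zero_right, Complex.ofReal_zero, zero_mul, zero_sub,
    Matrix.smul_mulVec, dotProduct_smul, smul_eq_mul, Complex.ofReal_neg, Complex.ofReal_div,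
    Complex.ofReal_ofNat] using hlim

end CentralLimit

section Chaos

/-- The law of `ξ² - 1`, for a standard normal variable `ξ`: the common law of the variables
`I₂(e ⊗ e)` with `‖e‖ = 1`. -/
noncomputable def centeredChiSq : Measure ℝ := (gaussianReal 0 1).map fun x => x ^ 2 - 1

instance : IsProbabilityMeasure centeredChiSq :=
  Measure.isProbabilityMeasure_map (by fun_prop)

theorem integrable_pow_gaussianReal (k : ℕ) (m : ℝ) (v : NNReal) :
    Integrable (fun x : ℝ => x ^ k) (gaussianReal m v) := by
  refine ((memLp_id_gaussianReal' (μ := m) (v := v) k (by simp)).integrable_norm_pow').mono'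
    (by fun_prop) (.of_forall fun x => by simp)

theorem integral_centeredChiSq : ∫ x, x ∂centeredChiSq = 0 := by
  rw [centeredChiSq, integral_map (by fun_prop) (by fun_prop),
    integral_sub (integrable_pow_gaussianReal 2 0 1) (integrable_const _),
    integral_sq_gaussianReal]
  simp

theorem memLp_id_centeredChiSq : MemLp id 2 centeredChiSq := by
  rw [centeredChiSq, memLp_map_measure_iff (by fun_prop) (by fun_prop),
    memLp_two_iff_integrable_sq (by fun_prop)]
  have hpoly : (fun x : ℝ => (x ^ 2 - 1) ^ 2) = fun x => x ^ 4 - 2 * x ^ 2 + 1 := by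
    funext x; ring
  simp only [Function.comp_apply, id_eq, hpoly]
  exact (((integrable_pow_gaussianReal 4 0 1).sub
    ((integrable_pow_gaussianReal 2 0 1).const_mul 2)).add (integrable_const 1))

theorem integral_sq_centeredChiSq : ∫ x, x ^ 2 ∂centeredChiSq = 2 := by
  rw [centeredChiSq, integral_map (by fun_prop) (by fun_prop)]
  have hpoly : ∀ x : ℝ, (x ^ 2 - 1) ^ 2 = x ^ 4 - 2 * x ^ 2 + 1 := fun x => by ring
  have h2 := integrable_pow_gaussianReal 2 0 1
  have h4 := integrable_pow_gaussianReal 4 0 1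
  have h42 : Integrable (fun x : ℝ => x ^ 4 - 2 * x ^ 2) (gaussianReal 0 1) :=
    h4.sub (h2.const_mul 2)
  simp only [hpoly]
  rw [integral_add h42 (integrable_const _),
    integral_sub h4 (h2.const_mul 2), integral_const_mul, integral_sq_gaussianReal,
    integral_pow_four_gaussianReal]
  norm_num

variable {𝔥 Ω : Type*} [NormedAddCommGroup 𝔥] [InnerProductSpace ℝ 𝔥] {mΩ : MeasurableSpace Ω}
  {P : Measure Ω} {W : 𝔥 → Ω → ℝ}

namespace IsIsonormal

theorem aemeasurable (hW : IsIsonormal W P) (h : 𝔥) : AEMeasurable (W h) P :=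
  hW.isGaussianProcess.aemeasurable h

theorem hasLaw (hW : IsIsonormal W P) (h : 𝔥) : HasLaw (W h) (gaussianReal 0 (‖h‖₊ ^ 2)) P where
  aemeasurable := hW.aemeasurable h
  map_eq := by
    have hvar : Var[W h; P] = ‖h‖ ^ 2 := by
      rw [variance_eq_integral (hW.aemeasurable h), hW.mean_zero, ← real_inner_self_eq_norm_sq,
        ← hW.covariance h h]
      simp only [sub_zero, sq]
    rw [(hW.isGaussianProcess.hasGaussianLaw_eval h).map_eq_gaussianReal, hvar, hW.mean_zero]
    congr 1
    ext
    simp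

theorem iIndepFun_of_orthogonal (hW : IsIsonormal W P) {ι : Type*} [Finite ι] {v : ι → 𝔥}
    (hv : Pairwise fun i j => ⟪v i, v j⟫_ℝ = 0) : iIndepFun (fun i => W (v i)) P := by
  have := hW.isGaussianProcess.isProbabilityMeasure
  have := Fintype.ofFinite ι
  let reindex : (↥(Finset.univ : Finset ι) → ℝ) →L[ℝ] (ι → ℝ) :=
    ContinuousLinearMap.pi fun i => ContinuousLinearMap.proj ⟨i, Finset.mem_univ i⟩
  have hgauss : HasGaussianLaw (fun ω i => W (v i) ω) P :=
    ((hW.isGaussianProcess.comp_right v).hasGaussianLaw Finset.univ).map reindex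
  refine hgauss.iIndepFun_of_covariance_eq_zero fun i j hij => ?_
  rw [covariance_eq_sub (hW.memLp _) (hW.memLp _), hW.mean_zero, zero_mul, sub_zero]
  exact (hW.covariance _ _).trans (hv hij)

theorem I₂_tmul_ae (hW : IsIsonormal W P) (g h : 𝔥) :
    hW.I₂ (g ⊗ₜ[ℝ] h) =ᵐ[P] fun ω => W g ω * W h ω - ⟪g, h⟫_ℝ := by
  rw [I₂, TensorProduct.lift.tmul]
  exact AEEqFun.coeFn_mk _ _

theorem I₂_sum_smul_tmul_self_ae (hW : IsIsonormal W P) {κ : Type*} (s : Finset κ) (a : κ → ℝ)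
    (v : κ → 𝔥) :
    hW.I₂ (∑ k ∈ s, a k • v k ⊗ₜ[ℝ] v k) =ᵐ[P]
      fun ω => ∑ k ∈ s, a k * (W (v k) ω ^ 2 - ‖v k‖ ^ 2) := by
  classical
  induction s using Finset.induction_on with
  | empty => simpa using! AEEqFun.coeFn_zero (μ := P) (β := ℝ)
  | insert i s hi ih =>
    rw [Finset.sum_insert hi, map_add, map_smul]
    filter_upwards [AEEqFun.coeFn_add (a i • hW.I₂ (v i ⊗ₜ[ℝ] v i))
      (hW.I₂ (∑ k ∈ s, a k • v k ⊗ₜ[ℝ] v k)), AEEqFun.coeFn_smul (a i) (hW.I₂ (v i ⊗ₜ[ℝ] v i)),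
      ih, hW.I₂_tmul_ae (v i) (v i)] with ω hadd hsmul hs hi'
    rw [hadd, Pi.add_apply, hsmul, Pi.smul_apply, hs, hi', Finset.sum_insert hi,
      real_inner_self_eq_norm_sq, smul_eq_mul, sq (W (v i) ω)]

theorem tendstoInDistribution_I₂_diagonal [IsProbabilityMeasure P] (hW : IsIsonormal W P)
    {ι : Type*} [Fintype ι] [DecidableEq ι] {κ : ℕ → Type*} [∀ n, Fintype (κ n)]
    {e : ∀ n, κ n → 𝔥} (he : ∀ n, Orthonormal ℝ (e n)) {l : ∀ n, κ n → EuclideanSpace ℝ ι}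
    {S : Matrix ι ι ℝ} (hS : ∀ i j, Tendsto (fun n => ∑ k, l n k i * l n k j) atTop (𝓝 (S i j)))
    {r : ℕ → ℝ} (hr : Tendsto r atTop (𝓝 0)) (hl : ∀ᶠ n in atTop, ∀ k, ‖l n k‖ ≤ r n) :
    TendstoInDistribution
      (fun n ω => WithLp.toLp 2 fun i => hW.I₂ (∑ k, l n k i • e n k ⊗ₜ[ℝ] e n k) ω)
      atTop id (fun _ => P) (multivariateGaussian 0 ((2 : ℝ) • S)) := by
  have hindep : ∀ n, iIndepFun (fun k ω => W (e n k) ω ^ 2 - 1) P := fun n =>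
    (hW.iIndepFun_of_orthogonal (he n).2).comp (fun _ x => x ^ 2 - 1) fun _ => by fun_prop
  have hlaw : ∀ n k, HasLaw (fun ω => W (e n k) ω ^ 2 - 1) centeredChiSq P := fun n k => by
    have hunit : ‖e n k‖₊ = 1 := NNReal.eq ((he n).1 k)
    have hgauss := hW.hasLaw (e n k)
    rw [hunit, one_pow] at hgauss
    exact HasLaw.comp (Y := fun x : ℝ => x ^ 2 - 1) ⟨by fun_prop, rfl⟩ hgauss
  refine (tendstoInDistribution_sum_smul (v := 2) memLp_id_centeredChiSq integral_centeredChiSq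
    integral_sq_centeredChiSq hindep hlaw hS hr hl).congr (fun n => ?_) .rfl
  have hae : ∀ᵐ ω ∂P, ∀ i, hW.I₂ (∑ k, l n k i • e n k ⊗ₜ[ℝ] e n k) ω =
      ∑ k, l n k i * (W (e n k) ω ^ 2 - ‖e n k‖ ^ 2) :=
    ae_all_iff.2 fun i => hW.I₂_sum_smul_tmul_self_ae _ (fun k => l n k i) (e n)
  filter_upwards [hae] with ω hω
  ext i
  simp only [hω, (he n).1, one_pow, WithLp.ofLp_sum, WithLp.ofLp_smul,
    Finset.sum_apply, Pi.smul_apply, smul_eq_mul, mul_comm]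

end IsIsonormal

end Chaos

section SymmetricTensors

variable {E 𝔥 : Type*} [NormedAddCommGroup E] [InnerProductSpace ℝ E] [NormedAddCommGroup 𝔥]
  [InnerProductSpace ℝ 𝔥]

theorem exists_orthonormalBasis_inner_tmul_eq_zero [FiniteDimensional ℝ E] {A : E ⊗[ℝ] E}
    (hA : TensorProduct.comm ℝ E E A = A) :
    ∃ b : OrthonormalBasis (Fin (Module.finrank ℝ E)) ℝ E,
      ∀ i j, i ≠ j → ⟪b i ⊗ₜ[ℝ] b j, A⟫_ℝ = 0 := by
  let u := stdOrthonormalBasis ℝ E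
  let T : E →ₗ[ℝ] E :=
    ∑ k, ((innerₗ (E ⊗[ℝ] E) A).comp ((TensorProduct.mk ℝ E E).flip (u k))).smulRight (u k)
  have hT : ∀ x y, ⟪T x, y⟫_ℝ = ⟪x ⊗ₜ[ℝ] y, A⟫_ℝ := fun x y => by
    rw [real_inner_comm A, ← innerₗ_apply_apply A]
    conv_rhs => rw [← u.sum_repr' y]
    simp only [T, LinearMap.sum_apply, LinearMap.smulRight_apply, LinearMap.comp_apply,
      LinearMap.flip_apply, TensorProduct.mk_apply, sum_inner, real_inner_smul_left,
      TensorProduct.tmul_sum, TensorProduct.tmul_smul, map_sum, map_smul, smul_eq_mul, mul_comm]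
  have hsymm : T.IsSymmetric := fun x y => by
    rw [hT, real_inner_comm (T y), hT, ← TensorProduct.inner_comm_comm, TensorProduct.comm_tmul, hA]
  refine ⟨hsymm.eigenvectorBasis rfl, fun i j hij => ?_⟩
  rw [← hT, hsymm.apply_eigenvectorBasis rfl i, real_inner_smul_left,
    (hsymm.eigenvectorBasis rfl).orthonormal.2 hij, mul_zero]

theorem exists_mapIncl_eq (A : 𝔥 ⊗[ℝ] 𝔥) :
    ∃ (F : Submodule ℝ 𝔥) (_ : FiniteDimensional ℝ F) (B : F ⊗[ℝ] F),
      TensorProduct.mapIncl F F B = A := by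
  obtain ⟨F₁, F₂, _, _, hA⟩ :=
    TensorProduct.exists_finite_submodule_of_setFinite {A} (Set.finite_singleton A)
  exact ⟨F₁ ⊔ F₂, inferInstance,
    TensorProduct.range_mapIncl_mono le_sup_left le_sup_right (hA rfl)⟩

theorem exists_orthonormal_eq_sum_smul_tmul_self {A : 𝔥 ⊗[ℝ] 𝔥}
    (hA : TensorProduct.comm ℝ 𝔥 𝔥 A = A) :
    ∃ (d : ℕ) (e : Fin d → 𝔥) (l : Fin d → ℝ), Orthonormal ℝ e ∧
      A = ∑ i, l i • e i ⊗ₜ[ℝ] e i := by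
  obtain ⟨F, _, B, rfl⟩ := exists_mapIncl_eq A
  have hB : TensorProduct.comm ℝ F F B = B := by
    apply (TensorProduct.mapInclIsometry F F).injective
    simpa only [TensorProduct.mapInclIsometry_apply, TensorProduct.mapIncl,
      TensorProduct.map_comm] using hA
  obtain ⟨b, hb⟩ := exists_orthonormalBasis_inner_tmul_eq_zero hB
  have hsum : B = ∑ i, ⟪b i ⊗ₜ[ℝ] b i, B⟫_ℝ • b i ⊗ₜ[ℝ] b i := by
    conv_lhs => rw [← (b.tensorProduct b).sum_repr' B, Fintype.sum_prod_type]
    refine Finset.sum_congr rfl fun i _ => ?_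
    simp only [OrthonormalBasis.tensorProduct_apply]
    exact Finset.sum_eq_single i (fun j _ hij => by rw [hb i j hij.symm, zero_smul])
      fun hi => absurd (Finset.mem_univ i) hi
  refine ⟨_, fun i => b i, fun i => ⟪b i ⊗ₜ[ℝ] b i, B⟫_ℝ,
    b.orthonormal.comp_linearIsometry F.subtypeₗᵢ, ?_⟩
  conv_lhs => rw [hsum]
  simp [TensorProduct.mapIncl]

end SymmetricTensors

section Contraction

variable {𝔥 : Type*} [NormedAddCommGroup 𝔥] [InnerProductSpace ℝ 𝔥]

/-- The contraction `⊗₁`, as a bilinear map. -/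
noncomputable def contrₗ : 𝔥 ⊗[ℝ] 𝔥 →ₗ[ℝ] 𝔥 ⊗[ℝ] 𝔥 →ₗ[ℝ] 𝔥 ⊗[ℝ] 𝔥 :=
  LinearMap.mk₂ ℝ contr₁
    (fun f f' g => by simp [contr₁, TensorProduct.add_tmul])
    (fun c f g => by simp [contr₁, ← TensorProduct.smul_tmul'])
    (fun f g g' => by simp [contr₁, TensorProduct.tmul_add])
    (fun c f g => by simp [contr₁])

theorem contrₗ_apply (f g : 𝔥 ⊗[ℝ] 𝔥) : contrₗ f g = contr₁ f g := rfl

theorem contrₗ_tmul (a b c d : 𝔥) :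
    contrₗ (a ⊗ₜ[ℝ] b) (c ⊗ₜ[ℝ] d) = ⟪a, c⟫_ℝ • (b ⊗ₜ[ℝ] d) := by
  simp [contrₗ_apply, contr₁]

theorem comm_contrₗ (f g : 𝔥 ⊗[ℝ] 𝔥) :
    TensorProduct.comm ℝ 𝔥 𝔥 (contrₗ f g) = contrₗ g f := by
  induction f with
  | zero => simp
  | add f f' hf hf' => simp [hf, hf']
  | tmul a b =>
    induction g with
    | zero => simp
    | add g g' hg hg' => simp [hg, hg']
    | tmul c d => simp [contrₗ_tmul, real_inner_comm]

-- Unification does not find the inner product of `𝔥 ⊗[ℝ] 𝔥` unless `F` is given explicitly.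
theorem inner_smul_left_tensor (c : ℝ) (f g : 𝔥 ⊗[ℝ] 𝔥) : ⟪c • f, g⟫_ℝ = c * ⟪f, g⟫_ℝ :=
  real_inner_smul_left (F := 𝔥 ⊗[ℝ] 𝔥) f g c

theorem inner_smul_right_tensor (c : ℝ) (f g : 𝔥 ⊗[ℝ] 𝔥) : ⟪f, c • g⟫_ℝ = c * ⟪f, g⟫_ℝ :=
  real_inner_smul_right (F := 𝔥 ⊗[ℝ] 𝔥) f g c

theorem inner_contrₗ_left (f g k : 𝔥 ⊗[ℝ] 𝔥) :
    ⟪contrₗ f g, k⟫_ℝ = ⟪g, contrₗ (TensorProduct.comm ℝ 𝔥 𝔥 f) k⟫_ℝ := by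
  induction f with
  | zero => simp
  | add f f' hf hf' => simp [inner_add_left, inner_add_right, hf, hf']
  | tmul a b =>
    induction g with
    | zero => simp
    | add g g' hg hg' => simp [inner_add_left, hg, hg']
    | tmul c d =>
      induction k with
      | zero => simp
      | add k k' hk hk' => simp [inner_add_right, hk, hk']
      | tmul p q =>
        simp only [contrₗ_tmul, TensorProduct.comm_tmul, inner_smul_left_tensor,
          inner_smul_right_tensor, TensorProduct.inner_tmul, real_inner_comm]
        ring

theorem contrₗ_sum_smul_tmul_self {κ : Type*} [Fintype κ] {e : κ → 𝔥} (he : Orthonormal ℝ e)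
    (a b : κ → ℝ) :
    contrₗ (∑ i, a i • e i ⊗ₜ[ℝ] e i) (∑ i, b i • e i ⊗ₜ[ℝ] e i) =
      ∑ i, (a i * b i) • e i ⊗ₜ[ℝ] e i := by
  classical
  simp [LinearMap.sum_apply, contrₗ_tmul, orthonormal_iff_ite.1 he, smul_smul, mul_comm]

theorem inner_sum_smul_tmul_self {κ : Type*} [Fintype κ] {e : κ → 𝔥} (he : Orthonormal ℝ e)
    (a b : κ → ℝ) :
    ⟪∑ i, a i • e i ⊗ₜ[ℝ] e i, ∑ i, b i • e i ⊗ₜ[ℝ] e i⟫_ℝ = ∑ i, a i * b i := by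
  classical
  simp [sum_inner, inner_sum, inner_smul_left_tensor, inner_smul_right_tensor,
    orthonormal_iff_ite.1 he, mul_comm]

section

variable {ι ι' : Type*} (s : Finset ι) (s' : Finset ι') (v : ι → 𝔥) (w : ι' → 𝔥)

theorem contrₗ_sum_tmul_self :
    contrₗ (∑ i ∈ s, v i ⊗ₜ[ℝ] v i) (∑ j ∈ s', w j ⊗ₜ[ℝ] w j) =
      ∑ i ∈ s, ∑ j ∈ s', ⟪v i, w j⟫_ℝ • v i ⊗ₜ[ℝ] w j := by
  rw [Finset.sum_comm]
  simp [LinearMap.sum_apply, contrₗ_tmul]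

theorem inner_sum_tmul_self :
    ⟪∑ i ∈ s, v i ⊗ₜ[ℝ] v i, ∑ j ∈ s', w j ⊗ₜ[ℝ] w j⟫_ℝ =
      ∑ i ∈ s, ∑ j ∈ s', ⟪v i, w j⟫_ℝ ^ 2 := by
  rw [Finset.sum_comm]
  simp [sum_inner, inner_sum, sq]

end

theorem contrₗ_contrₗ_right (f g k : 𝔥 ⊗[ℝ] 𝔥) :
    contrₗ f (contrₗ g k) = contrₗ (contrₗ (TensorProduct.comm ℝ 𝔥 𝔥 g) f) k := by
  induction f with
  | zero => simp
  | add f f' hf hf' => simp [hf, hf']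
  | tmul a b =>
    induction g with
    | zero => simp
    | add g g' hg hg' => simp [hg, hg']
    | tmul c d =>
      induction k with
      | zero => simp
      | add k k' hk hk' => simp [hk, hk']
      | tmul p q => simp [contrₗ_tmul, smul_smul, mul_comm, real_inner_comm]

section Polarization

variable {x y : 𝔥 ⊗[ℝ] 𝔥} (hx : TensorProduct.comm ℝ 𝔥 𝔥 x = x)
  (hy : TensorProduct.comm ℝ 𝔥 𝔥 y = y) (p q : ℝ)

theorem inner_sub_smul_self (x y : 𝔥 ⊗[ℝ] 𝔥) : ⟪p • x - q • y, p • x - q • y⟫_ℝ =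
    p ^ 2 * ⟪x, x⟫_ℝ - 2 * p * q * ⟪x, y⟫_ℝ + q ^ 2 * ⟪y, y⟫_ℝ := by
  simp only [inner_sub_left, inner_sub_right, inner_smul_left_tensor, inner_smul_right_tensor,
    real_inner_comm x y]
  ring

theorem inner_contrₗ_contrₗ_swap (x y : 𝔥 ⊗[ℝ] 𝔥) :
    ⟪contrₗ x x, contrₗ y x⟫_ℝ = ⟪contrₗ x x, contrₗ x y⟫_ℝ := by
  rw [← TensorProduct.inner_comm_comm, comm_contrₗ x x, comm_contrₗ y x]

include hx

theorem inner_contrₗ_swap (y : 𝔥 ⊗[ℝ] 𝔥) : ⟪x, contrₗ y x⟫_ℝ = ⟪x, contrₗ x y⟫_ℝ := by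
  rw [← TensorProduct.inner_comm_comm, comm_contrₗ, hx]

theorem inner_contrₗ_self_right (y : 𝔥 ⊗[ℝ] 𝔥) : ⟪y, contrₗ x x⟫_ℝ = ⟪x, contrₗ x y⟫_ℝ := by
  rw [real_inner_comm (contrₗ x x) y, inner_contrₗ_left, hx]

include hy

theorem inner_contrₗ_contrₗ_self :
    ⟪contrₗ x y, contrₗ x y⟫_ℝ = ⟪contrₗ x x, contrₗ y y⟫_ℝ := by
  rw [inner_contrₗ_left, contrₗ_contrₗ_right, hx, ← TensorProduct.inner_comm_comm, comm_contrₗ,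
    hy, real_inner_comm (contrₗ y (contrₗ x x)) y, inner_contrₗ_left, hy]

theorem inner_sub_smul_contrₗ :
    ⟪p • x - q • y, contrₗ (p • x - q • y) (p • x - q • y)⟫_ℝ =
      p ^ 3 * ⟪x, contrₗ x x⟫_ℝ - 3 * p ^ 2 * q * ⟪x, contrₗ x y⟫_ℝ
        + 3 * p * q ^ 2 * ⟪x, contrₗ y y⟫_ℝ - q ^ 3 * ⟪y, contrₗ y y⟫_ℝ := by
  simp only [map_sub, map_smul, LinearMap.sub_apply, LinearMap.smul_apply, inner_sub_left,
    inner_sub_right, inner_smul_left_tensor, inner_smul_right_tensor, smul_sub]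
  rw [inner_contrₗ_swap hx y, inner_contrₗ_swap hy x, inner_contrₗ_self_right hx y,
    inner_contrₗ_self_right hy x]
  ring

theorem inner_contrₗ_sub_smul_self :
    ⟪contrₗ (p • x - q • y) (p • x - q • y), contrₗ (p • x - q • y) (p • x - q • y)⟫_ℝ =
      p ^ 4 * ⟪contrₗ x x, contrₗ x x⟫_ℝ - 4 * p ^ 3 * q * ⟪contrₗ x x, contrₗ x y⟫_ℝ
        + p ^ 2 * q ^ 2 * (4 * ⟪contrₗ x x, contrₗ y y⟫_ℝ + 2 * ⟪contrₗ x y, contrₗ y x⟫_ℝ)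
        - 4 * p * q ^ 3 * ⟪contrₗ x y, contrₗ y y⟫_ℝ
        + q ^ 4 * ⟪contrₗ y y, contrₗ y y⟫_ℝ := by
  simp only [map_sub, map_smul, LinearMap.sub_apply, LinearMap.smul_apply, inner_sub_left,
    inner_sub_right, inner_smul_left_tensor, inner_smul_right_tensor, smul_sub]
  rw [real_inner_comm (contrₗ x x) (contrₗ x y), real_inner_comm (contrₗ x x) (contrₗ y x),
    real_inner_comm (contrₗ x x) (contrₗ y y), real_inner_comm (contrₗ y y) (contrₗ y x),
    real_inner_comm (contrₗ x y) (contrₗ y x), inner_contrₗ_contrₗ_swap x y,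
    ← inner_contrₗ_contrₗ_swap y x, real_inner_comm (contrₗ x y) (contrₗ y y),
    inner_contrₗ_contrₗ_self hx hy, inner_contrₗ_contrₗ_self hy hx,
    real_inner_comm (contrₗ x x) (contrₗ y y)]
  ring

end Polarization

section Sums

variable {ι : Type*} (s s' t t' : Finset ι) (v w v' w' : ι → 𝔥)

theorem comm_sum_tmul_self :
    TensorProduct.comm ℝ 𝔥 𝔥 (∑ i ∈ s, v i ⊗ₜ[ℝ] v i) = ∑ i ∈ s, v i ⊗ₜ[ℝ] v i := by
  simp only [map_sum, TensorProduct.comm_tmul]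

theorem inner_sum_contrₗ_sum :
    ⟪∑ i ∈ s, v i ⊗ₜ[ℝ] v i, contrₗ (∑ j ∈ s', w j ⊗ₜ[ℝ] w j) (∑ k ∈ t, v' k ⊗ₜ[ℝ] v' k)⟫_ℝ =
      ∑ i ∈ s, ∑ j ∈ s', ∑ k ∈ t, ⟪v i, w j⟫_ℝ * ⟪w j, v' k⟫_ℝ * ⟪v i, v' k⟫_ℝ := by
  rw [contrₗ_sum_tmul_self, sum_inner]
  simp_rw [inner_sum, inner_smul_right_tensor, TensorProduct.inner_tmul]
  refine Finset.sum_congr rfl fun i _ => Finset.sum_congr rfl fun j _ =>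
    Finset.sum_congr rfl fun k _ => ?_
  ring

theorem inner_contrₗ_sum_contrₗ_sum :
    ⟪contrₗ (∑ i ∈ s, v i ⊗ₜ[ℝ] v i) (∑ j ∈ s', w j ⊗ₜ[ℝ] w j),
      contrₗ (∑ k ∈ t, v' k ⊗ₜ[ℝ] v' k) (∑ l ∈ t', w' l ⊗ₜ[ℝ] w' l)⟫_ℝ =
      ∑ i ∈ s, ∑ j ∈ s', ∑ k ∈ t, ∑ l ∈ t',
        ⟪v i, w j⟫_ℝ * ⟪v' k, w' l⟫_ℝ * ⟪v i, v' k⟫_ℝ * ⟪w j, w' l⟫_ℝ := by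
  rw [contrₗ_sum_tmul_self, contrₗ_sum_tmul_self, sum_inner]
  simp_rw [sum_inner, inner_sum, inner_smul_left_tensor, inner_smul_right_tensor,
    TensorProduct.inner_tmul]
  refine Finset.sum_congr rfl fun i _ => Finset.sum_congr rfl fun j _ =>
    Finset.sum_congr rfl fun k _ => Finset.sum_congr rfl fun l _ => ?_
  ring

end Sums

theorem sum_sum_mul_mul_le {ι : Type*} {s : Finset ι} {a : ι → ι → ℝ} {L : ℝ}
    (ha : ∀ i j, a i j = a j i) (hL : ∀ i ∈ s, ∑ j ∈ s, |a i j| ≤ L) (x : ι → ℝ) :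
    ∑ i ∈ s, ∑ j ∈ s, x i * x j * a i j ≤ L * ∑ i ∈ s, x i ^ 2 := by
  have amgm : ∀ i j, x i * x j * a i j ≤ x i ^ 2 / 2 * |a i j| + x j ^ 2 / 2 * |a j i| := by
    intro i j
    rw [← ha i j, ← add_mul]
    refine (le_abs_self _).trans ?_
    rw [abs_mul]
    exact mul_le_mul_of_nonneg_right (abs_le.2 ⟨by nlinarith [sq_nonneg (x i + x j)],
      by nlinarith [sq_nonneg (x i - x j)]⟩) (abs_nonneg _)
  calc ∑ i ∈ s, ∑ j ∈ s, x i * x j * a i j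
      ≤ ∑ i ∈ s, ∑ j ∈ s, (x i ^ 2 / 2 * |a i j| + x j ^ 2 / 2 * |a j i|) :=
        Finset.sum_le_sum fun i _ => Finset.sum_le_sum fun j _ => amgm i j
    _ = ∑ i ∈ s, x i ^ 2 * ∑ j ∈ s, |a i j| := by
        simp only [Finset.sum_add_distrib]
        rw [Finset.sum_comm (f := fun i j => x j ^ 2 / 2 * |a j i|), ← Finset.sum_add_distrib]
        refine Finset.sum_congr rfl fun i _ => ?_
        rw [← Finset.mul_sum]
        ring
    _ ≤ L * ∑ i ∈ s, x i ^ 2 := by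
        rw [Finset.mul_sum]
        refine Finset.sum_le_sum fun i hi => ?_
        rw [mul_comm L]
        exact mul_le_mul_of_nonneg_left (hL i hi) (sq_nonneg _)

theorem sum_inner_sq_le {ι : Type*} {s : Finset ι} {v : ι → 𝔥} {L : ℝ} (hL₀ : 0 ≤ L)
    (hL : ∀ i ∈ s, ∑ j ∈ s, |⟪v i, v j⟫_ℝ| ≤ L) (e : 𝔥) :
    ∑ i ∈ s, ⟪v i, e⟫_ℝ ^ 2 ≤ L * ‖e‖ ^ 2 := by
  set S := ∑ i ∈ s, ⟪v i, e⟫_ℝ ^ 2 with hS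
  set w := ∑ i ∈ s, ⟪v i, e⟫_ℝ • v i with hw
  have hS₀ : 0 ≤ S := Finset.sum_nonneg fun i _ => sq_nonneg _
  have inner_w : ⟪w, e⟫_ℝ = S := by
    simp only [hw, hS, sum_inner, real_inner_smul_left, sq]
  have norm_w : ‖w‖ ^ 2 ≤ L * S := by
    rw [← real_inner_self_eq_norm_sq]
    simp only [hw, sum_inner, inner_sum, real_inner_smul_left, real_inner_smul_right,
      ← mul_assoc]
    refine sum_sum_mul_mul_le (fun i j => real_inner_comm _ _) (fun i hi => ?_) _
    simp_rw [real_inner_comm (v i)]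
    exact hL i hi
  have cauchy_schwarz : S ^ 2 ≤ L * S * ‖e‖ ^ 2 := by
    refine le_trans ?_ (mul_le_mul_of_nonneg_right norm_w (sq_nonneg ‖e‖))
    rw [← mul_pow, ← inner_w, ← sq_abs]
    exact pow_le_pow_left₀ (abs_nonneg _) (abs_real_inner_le_norm w e) 2
  rcases hS₀.eq_or_lt with h | h
  · rw [← h]; positivity
  · nlinarith

end Contraction

section ContractedChaos

theorem norm_toLp_pair_le (x y : ℝ) : ‖!₂[x, y]‖ ≤ |x| + |y| := by
  rw [EuclideanSpace.norm_eq, Fin.sum_univ_two]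
  refine Real.sqrt_le_iff.2 ⟨by positivity, ?_⟩
  simp only [Matrix.cons_val_zero, Matrix.cons_val_one, Real.norm_eq_abs]
  nlinarith [abs_nonneg x, abs_nonneg y, mul_nonneg (abs_nonneg x) (abs_nonneg y)]

namespace IsIsonormal

variable {𝔥 Ω : Type*} [NormedAddCommGroup 𝔥] [InnerProductSpace ℝ 𝔥] {mΩ : MeasurableSpace Ω}
  {P : Measure Ω} {W : 𝔥 → Ω → ℝ}

/-- The eigenvalues of `A n` are at most `r n`, and those of its contraction are their squares:
the two kernels are diagonal in the same orthonormal family. -/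
theorem tendstoInDistribution_I₂_contrₗ_self [IsProbabilityMeasure P] (hW : IsIsonormal W P)
    {A : ℕ → 𝔥 ⊗[ℝ] 𝔥} (hA : ∀ n, TensorProduct.comm ℝ 𝔥 𝔥 (A n) = A n) {c r : ℕ → ℝ}
    (hr : Tendsto r atTop (𝓝 0)) (hcr : Tendsto (fun n => c n * r n ^ 2) atTop (𝓝 0))
    (hAr : ∀ᶠ n in atTop, ∀ e : 𝔥, ‖e‖ = 1 → |⟪A n, e ⊗ₜ[ℝ] e⟫_ℝ| ≤ r n)
    {S : Matrix (Fin 2) (Fin 2) ℝ}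
    (hS : ∀ i j, Tendsto (fun n => ⟪![A n, c n • contrₗ (A n) (A n)] i,
      ![A n, c n • contrₗ (A n) (A n)] j⟫_ℝ) atTop (𝓝 (S i j))) :
    TendstoInDistribution (fun n ω => WithLp.toLp 2 fun i =>
        hW.I₂ (![A n, c n • contrₗ (A n) (A n)] i) ω)
      atTop id (fun _ => P) (multivariateGaussian 0 ((2 : ℝ) • S)) := by
  choose d e a he hAe using fun n => exists_orthonormal_eq_sum_smul_tmul_self (hA n)
  let l : ∀ n, Fin (d n) → EuclideanSpace ℝ (Fin 2) := fun n k => !₂[a n k, c n * a n k ^ 2]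
  have hl : ∀ n i, ![A n, c n • contrₗ (A n) (A n)] i = ∑ k, l n k i • e n k ⊗ₜ[ℝ] e n k := by
    intro n i
    fin_cases i
    · simpa [l] using hAe n
    · change c n • contrₗ (A n) (A n) = _
      rw [hAe n, contrₗ_sum_smul_tmul_self (he n)]
      simp [l, Finset.smul_sum, smul_smul, sq]
  have hinner : ∀ n k, ⟪A n, e n k ⊗ₜ[ℝ] e n k⟫_ℝ = a n k := fun n k => by
    conv_lhs => rw [hAe n]
    simp [sum_inner, inner_smul_left_tensor, orthonormal_iff_ite.1 (he n)]
  have hnorm : ∀ᶠ n in atTop, ∀ k, ‖l n k‖ ≤ r n + |c n * r n ^ 2| := by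
    filter_upwards [hAr] with n hn k
    have ha : |a n k| ≤ r n := hinner n k ▸ hn (e n k) ((he n).1 k)
    have hca : |c n * a n k ^ 2| ≤ |c n * r n ^ 2| := by
      rw [abs_mul, abs_mul]
      exact mul_le_mul_of_nonneg_left
        (by simpa using pow_le_pow_left₀ (abs_nonneg _) ha 2) (abs_nonneg _)
    exact (norm_toLp_pair_le _ _).trans (add_le_add ha hca)
  simp only [hl] at hS ⊢
  simp only [inner_sum_smul_tmul_self (he _)] at hS
  exact hW.tendstoInDistribution_I₂_diagonal he hS
    (by simpa using hr.add hcr.abs) hnorm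

end IsIsonormal

end ContractedChaos

section Correlation

theorem hasDerivAt_iterate_fwdDiff_rpow (k : ℕ) (p : ℝ) {x : ℝ} (hx : 0 < x) :
    HasDerivAt ((fwdDiff 1)^[k] fun y : ℝ => y ^ p)
      (p * (fwdDiff 1)^[k] (fun y : ℝ => y ^ (p - 1)) x) x := by
  induction k generalizing x with
  | zero => simpa using Real.hasDerivAt_rpow_const (p := p) (Or.inl hx.ne')
  | succ k ih =>
    rw [Function.iterate_succ_apply', Function.iterate_succ_apply']
    have h1 := (ih (x := x + 1) (by linarith)).comp_add_const x 1
    refine (h1.sub (ih hx)).congr_deriv ?_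
    rw [fwdDiff]; ring

theorem exists_iterate_fwdDiff_rpow_le (k : ℕ) (p : ℝ) (hp : p ≤ k) :
    ∃ C, 0 ≤ C ∧ ∀ x : ℝ, 1 ≤ x →
      |(fwdDiff 1)^[k] (fun y : ℝ => y ^ p) x| ≤ C * x ^ (p - k) := by
  induction k generalizing p with
  | zero =>
    refine ⟨1, zero_le_one, fun x hx => ?_⟩
    simp [abs_of_nonneg (Real.rpow_nonneg (zero_le_one.trans hx) p)]
  | succ k ih =>
    push_cast at hp
    obtain ⟨C, hC, h⟩ := ih (p - 1) (by linarith)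
    refine ⟨|p| * C, by positivity, fun x hx => ?_⟩
    have hx0 : 0 < x := by linarith
    obtain ⟨ξ, hξ, he⟩ := exists_hasDerivAt_eq_slope ((fwdDiff 1)^[k] fun y : ℝ => y ^ p)
      (fun y => p * (fwdDiff 1)^[k] (fun y : ℝ => y ^ (p - 1)) y) (lt_add_one x)
      (fun y hy => (hasDerivAt_iterate_fwdDiff_rpow k p
        (hx0.trans_le hy.1)).continuousAt.continuousWithinAt)
      (fun y hy => hasDerivAt_iterate_fwdDiff_rpow k p (hx0.trans hy.1))
    rw [add_sub_cancel_left, div_one] at he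
    rw [Function.iterate_succ_apply', fwdDiff, ← he, abs_mul, mul_assoc]
    refine mul_le_mul_of_nonneg_left ((h ξ (hx.trans hξ.1.le)).trans ?_) (abs_nonneg _)
    refine mul_le_mul_of_nonneg_left ?_ hC
    rw [show p - ((k + 1 : ℕ) : ℝ) = p - 1 - k by push_cast; ring]
    exact Real.rpow_le_rpow_of_nonpos hx0 hξ.1.le (by linarith)

theorem rhoHat_neg (H : ℝ) (j : ℤ) : rhoHat H (-j) = rhoHat H j := by
  have h : ∀ x y : ℝ, |-x - y| = |x + y| := fun x y => by
    rw [← abs_neg]; congr 1; ring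
  have h' : ∀ x y : ℝ, |-x + y| = |x - y| := fun x y => by
    rw [← abs_neg]; congr 1; ring
  simp only [rhoHat, Int.cast_neg, h, h', abs_neg]
  ring

theorem rhoHat_congr (H : ℝ) {i j : ℤ} (h : i = j ∨ i = -j) : rhoHat H i = rhoHat H j := by
  rcases h with rfl | rfl
  · rfl
  · exact rhoHat_neg H j

theorem rhoHat_zero {H : ℝ} (h0 : 0 < H) : rhoHat H 0 = cH H := by
  simp [rhoHat, cH, Real.zero_rpow (by positivity : 2 * H ≠ 0)]
  ring

theorem rhoHat_add_three (H : ℝ) (n : ℕ) :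
    rhoHat H ((n + 3 : ℕ) : ℤ) =
      -(1 / 2) * (fwdDiff 1)^[4] (fun y : ℝ => y ^ (2 * H)) (n + 1) := by
  have : (0 : ℝ) ≤ n := Nat.cast_nonneg n
  simp only [Function.iterate_succ, Function.iterate_zero, Function.comp_apply, id, fwdDiff,
    rhoHat]
  push_cast
  rw [abs_of_nonneg (by linarith : (0 : ℝ) ≤ n + 3 - 2),
    abs_of_nonneg (by linarith : (0 : ℝ) ≤ n + 3 - 1),
    abs_of_nonneg (by linarith : (0 : ℝ) ≤ (n : ℝ) + 3),
    abs_of_nonneg (by linarith : (0 : ℝ) ≤ n + 3 + 1),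
    abs_of_nonneg (by linarith : (0 : ℝ) ≤ n + 3 + 2)]
  ring_nf

theorem summable_rhoHat {H : ℝ} (h1 : H < 1) : Summable (rhoHat H) := by
  have hnat : Summable fun n : ℕ => rhoHat H (n : ℤ) := by
    rw [← summable_nat_add_iff 3]
    obtain ⟨C, -, h⟩ := exists_iterate_fwdDiff_rpow_le 4 (2 * H) (by push_cast; linarith)
    have hs : Summable fun n : ℕ => C * ((n : ℝ) + 1) ^ (2 * H - 4) := by
      refine Summable.mul_left C ?_
      have := (summable_nat_add_iff 1).2 (Real.summable_nat_rpow (p := 2 * H - 4)|>.2 (by linarith))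
      simpa using this
    refine Summable.of_norm_bounded hs fun n => ?_
    rw [rhoHat_add_three, Real.norm_eq_abs, abs_mul]
    have := h (n + 1) (by linarith [Nat.cast_nonneg (α := ℝ) n])
    push_cast at this
    have h2 : |(-(1 / 2) : ℝ)| ≤ 1 := by norm_num
    exact (mul_le_of_le_one_left (abs_nonneg _) h2).trans this
  exact Summable.of_nat_of_neg hnat (by simpa [rhoHat_neg] using hnat)

theorem rhoTilde_eq (H : ℝ) (j : ℤ) :
    rhoTilde H j =
      1 / 2 ^ (2 * H) * (rhoHat H (j + 1) + 2 * rhoHat H j + rhoHat H (j - 1)) := by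
  rw [rhoTilde, Real.rpow_add two_pos, Real.rpow_one]
  simp only [rhoHat]
  push_cast
  rw [show (j : ℝ) + 1 - 2 = j - 1 by ring, show (j : ℝ) + 1 - 1 = j by ring,
    show (j : ℝ) + 1 + 1 = j + 2 by ring, show (j : ℝ) + 1 + 2 = j + 3 by ring,
    show (j : ℝ) - 1 - 2 = j - 3 by ring, show (j : ℝ) - 1 - 1 = j - 2 by ring,
    show (j : ℝ) - 1 + 1 = j by ring, show (j : ℝ) - 1 + 2 = j + 1 by ring]
  field_simp
  ring

theorem rhoTilde_neg (H : ℝ) (j : ℤ) : rhoTilde H (-j) = rhoTilde H j := by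
  rw [rhoTilde_eq, rhoTilde_eq, rhoHat_neg, show -j + 1 = -(j - 1) by ring,
    show -j - 1 = -(j + 1) by ring, rhoHat_neg, rhoHat_neg]
  ring

theorem rhoTilde_congr (H : ℝ) {i j : ℤ} (h : i = j ∨ i = -j) : rhoTilde H i = rhoTilde H j := by
  rcases h with rfl | rfl
  · rfl
  · exact rhoTilde_neg H j

theorem summable_rhoTilde {H : ℝ} (h1 : H < 1) : Summable (rhoTilde H) := by
  have h := summable_rhoHat h1
  have := ((h.comp_injective (add_left_injective 1)).add (h.mul_left 2)).add
    (h.comp_injective (sub_left_injective (b := (1 : ℤ))))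
  exact (this.mul_left (1 / 2 ^ (2 * H))).congr fun j => (rhoTilde_eq H j).symm

theorem summable_mul_mul_comp_of_injective {ι α β δ : Type*} {f : α → ℝ} {g : β → ℝ}
    {k : δ → ℝ} (hf : Summable f) (hg : Summable g) (hk : Summable k)
    (φ : ι → α × β) (hφ : Function.Injective φ) (ψ : ι → δ) :
    Summable fun i => f (φ i).1 * g (φ i).2 * k (ψ i) := by
  have h2 : Summable fun p : α × β => ‖f p.1 * g p.2‖ := hf.norm.mul_norm hg.norm
  refine Summable.of_norm_bounded ((h2.comp_injective hφ).mul_right (∑' d, ‖k d‖)) fun i => ?_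
  rw [norm_mul, Function.comp_apply]
  exact mul_le_mul_of_nonneg_left (hk.norm.le_tsum _ fun _ _ => norm_nonneg _) (norm_nonneg _)

theorem summable_mul_mul_mul_comp_of_injective {ι α β γ δ : Type*}
    {f : α → ℝ} {g : β → ℝ} {h : γ → ℝ} {k : δ → ℝ} (hf : Summable f) (hg : Summable g)
    (hh : Summable h) (hk : Summable k) (φ : ι → α × β × γ) (hφ : Function.Injective φ)
    (ψ : ι → δ) :
    Summable fun i => f (φ i).1 * g (φ i).2.1 * h (φ i).2.2 * k (ψ i) := by
  have h2 : Summable fun p : β × γ => g p.1 * h p.2 :=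
    summable_mul_of_summable_norm hg.norm hh.norm
  simpa only [mul_assoc] using summable_mul_mul_comp_of_injective hf h2 hk φ hφ ψ

theorem summable_sq_of_summable {α : Type*} {f : α → ℝ} (hf : Summable f) :
    Summable fun i => f i ^ 2 := by
  refine Summable.of_norm_bounded (hf.norm.mul_right (∑' d, ‖f d‖)) fun i => ?_
  rw [sq, norm_mul]
  exact mul_le_mul_of_nonneg_left (hf.norm.le_tsum _ fun _ _ => norm_nonneg _) (norm_nonneg _)

section Series

variable {H : ℝ} (h1 : H < 1)

include h1

theorem summable_rhoHat_sq : Summable fun j => rhoHat H j ^ 2 :=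
  summable_sq_of_summable (summable_rhoHat h1)

theorem summable_term11 : Summable (term11 H) :=
  (summable_rhoHat_sq h1).comp_injective (i := fun k : ℕ => (k : ℤ) + 1) fun i j h => by
    simpa using h

theorem summable_term12 : Summable (term12 H) := summable_sq_of_summable (summable_rhoTilde h1)

theorem summable_term1_11 : Summable (term1_11 H) :=
  summable_mul_mul_comp_of_injective (summable_rhoHat h1) (summable_rhoHat h1) (summable_rhoHat h1)
    (fun i : ℤ × ℤ => (i.1, i.1 - i.2)) (fun i j h => by grind) fun i => i.2

theorem summable_term2_11 : Summable (term2_11 H) :=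
  summable_mul_mul_comp_of_injective (summable_rhoHat h1) (summable_rhoTilde h1)
    (summable_rhoTilde h1) (fun i : ℤ × ℤ => (i.1, i.2 - 2 * i.1)) (fun i j h => by grind)
    fun i => i.2

theorem summable_term1_22 : Summable (term1_22 H) :=
  summable_mul_mul_comp_of_injective (summable_rhoHat h1) (summable_rhoTilde h1)
    (summable_rhoTilde h1) (fun i : ℤ × ℤ => (i.1, i.1 - i.2)) (fun i j h => by grind)
    fun i => i.2

theorem summable_term11_11 : Summable (term11_11 H) :=
  summable_mul_mul_mul_comp_of_injective (summable_rhoHat h1) (summable_rhoHat h1)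
    (summable_rhoHat h1) (summable_rhoHat h1)
    (fun i : ℤ × ℤ × ℤ => (i.1, i.1 - i.2.1, i.2.1 - i.2.2))
    (fun i j h => by grind) fun i => i.2.2

theorem summable_term11_12 : Summable (term11_12 H) :=
  summable_mul_mul_mul_comp_of_injective (summable_rhoHat h1) (summable_rhoTilde h1)
    (summable_rhoTilde h1) (summable_rhoHat h1)
    (fun i : ℤ × ℤ × ℤ => (i.1, 2 * i.1 - i.2.1, i.2.1 - 2 * i.2.2)) (fun i j h => by grind)
    fun i => i.2.2

theorem summable_term12_22 : Summable (term12_22 H) :=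
  summable_mul_mul_mul_comp_of_injective (summable_rhoHat h1) (summable_rhoHat h1)
    (summable_rhoTilde h1) (summable_rhoTilde h1)
    (fun i : ℤ × ℤ × ℤ => (i.1, i.1 - i.2.1, i.2.1 - i.2.2)) (fun i j h => by grind)
    fun i => i.2.2

theorem summable_term12_12a : Summable (term12_12a H) :=
  summable_mul_mul_mul_comp_of_injective (summable_rhoHat h1) (summable_rhoTilde h1)
    (summable_rhoHat h1) (summable_rhoTilde h1)
    (fun i : ℤ × ℤ × ℤ => (i.1, 2 * i.1 - i.2.1, i.2.1 - i.2.2)) (fun i j h => by grind)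
    fun i => i.2.2

theorem summable_term12_12b : Summable (term12_12b H) :=
  summable_mul_mul_mul_comp_of_injective (summable_rhoTilde h1) (summable_rhoTilde h1)
    (summable_rhoTilde h1) (summable_rhoTilde h1)
    (fun i : ℤ × ℤ × ℤ => (2 * i.1, 2 * i.1 - i.2.1, i.2.1 - 2 * i.2.2))
    (fun i j h => by grind) fun i => 2 * i.2.2

theorem summable_term12_12c : Summable (term12_12c H) :=
  summable_mul_mul_mul_comp_of_injective (summable_rhoTilde h1) (summable_rhoTilde h1)
    (summable_rhoTilde h1) (summable_rhoTilde h1)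
    (fun i : ℤ × ℤ × ℤ => (2 * i.1 + 1, 2 * i.1 - i.2.1, i.2.1 - 2 * i.2.2))
    (fun i j h => by grind) fun i => 2 * i.2.2 + 1

end Series

/-- The general term of the second part of `κ(1,2;1,2)`, before it is split according to the parity
of the first index into `term12_12b` and `term12_12c`. -/
noncomputable def term12_12bc (H : ℝ) (i : ℤ × ℤ × ℤ) : ℝ :=
  rhoTilde H i.1 * rhoTilde H (2 * i.2.1 - i.1) * rhoTilde H (i.2.2 - 2 * i.2.1)
    * rhoTilde H i.2.2

theorem summable_term12_12bc {H : ℝ} (h1 : H < 1) : Summable (term12_12bc H) :=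
  summable_mul_mul_mul_comp_of_injective (summable_rhoTilde h1) (summable_rhoTilde h1)
    (summable_rhoTilde h1) (summable_rhoTilde h1)
    (fun i : ℤ × ℤ × ℤ => (i.1, 2 * i.2.1 - i.1, i.2.2 - 2 * i.2.1)) (fun i j h => by grind)
    fun i => i.2.2

section Parity

theorem hasSum_comp_add_comp_of_parity {α β : Type*} {f : β → ℝ} (hf : Summable f) (p : β → ℤ)
    {φ χ : α → β} (hφ : Function.Injective φ) (hχ : Function.Injective χ)
    (even : ∀ b, b ∈ Set.range φ ↔ Even (p b)) (odd : ∀ b, b ∈ Set.range χ ↔ Odd (p b)) :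
    HasSum (fun a => f (φ a) + f (χ a)) (∑' b, f b) := by
  have isCompl : IsCompl (Set.range φ) (Set.range χ) := by
    rw [show Set.range χ = (Set.range φ)ᶜ by ext b; simp [odd, even, -Set.mem_range]]
    exact isCompl_compl
  have hφf := (hf.comp_injective hφ).hasSum
  have hχf := (hf.comp_injective hχ).hasSum
  rw [((hφ.hasSum_range_iff.2 hφf).add_isCompl isCompl (hχ.hasSum_range_iff.2 hχf)).tsum_eq]
  exact hφf.add hχf

variable {H : ℝ} (h1 : H < 1)

include h1

theorem hasSum_term11_22 : HasSum (term11_22 H) (∑' i, term12_12a H i) := by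
  have split := hasSum_comp_add_comp_of_parity (summable_term12_12a h1) (fun y => y.2.2)
    (φ := fun i : ℤ × ℤ × ℤ => (i.2.1 - i.1, i.2.2 - 2 * i.1, -(2 * i.1)))
    (χ := fun i : ℤ × ℤ × ℤ => (i.2.1 - i.1, i.2.2 - 2 * i.1 - 1, -(2 * i.1 + 1)))
    (fun i j h => by grind) (fun i j h => by grind)
    (fun y => ⟨?_, fun ⟨k, hk⟩ => ⟨(-k, y.1 - k, y.2.1 - 2 * k), ?_⟩⟩)
    (fun y => ⟨?_, fun ⟨k, hk⟩ => ⟨(-(k + 1), y.1 - (k + 1), y.2.1 - 2 * (k + 1) + 1), ?_⟩⟩)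
  · convert split using 2 with i
    simp only [term11_22, term12_12a]
    rw [rhoHat_congr H (i := i.2.1 - i.1) (j := i.1 - i.2.1) (by omega),
      rhoTilde_congr H (i := -(2 * i.1)) (j := 2 * i.1) (by omega),
      rhoTilde_congr H (i := -(2 * i.1 + 1)) (j := 2 * i.1 + 1) (by omega)]
    ring_nf
  · rintro ⟨i, rfl⟩; exact ⟨-i.1, by ring⟩
  · ext <;> dsimp only <;> omega
  · rintro ⟨i, rfl⟩; exact ⟨-i.1 - 1, by ring⟩
  · ext <;> dsimp only <;> omega

theorem hasSum_term12_12b_add_term12_12c :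
    HasSum (fun i => term12_12b H i + term12_12c H i) (∑' i, term12_12bc H i) := by
  have split := hasSum_comp_add_comp_of_parity (summable_term12_12bc h1) (fun y => y.1)
    (φ := fun i : ℤ × ℤ × ℤ => (-(2 * i.1), i.2.2 - i.1, i.2.1 - 2 * i.1))
    (χ := fun i : ℤ × ℤ × ℤ => (-(2 * i.1 + 1), i.2.2 - i.1, i.2.1 - 2 * i.1))
    (fun i j h => by grind) (fun i j h => by grind)
    (fun y => ⟨?_, fun ⟨k, hk⟩ => ⟨(-k, y.2.2 - 2 * k, y.2.1 - k), ?_⟩⟩)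
    (fun y => ⟨?_, fun ⟨k, hk⟩ => ⟨(-(k + 1), y.2.2 - 2 * (k + 1), y.2.1 - (k + 1)), ?_⟩⟩)
  · convert split using 2 with i
    simp only [term12_12b, term12_12c, term12_12bc]
    rw [rhoTilde_congr H (i := i.2.1 - 2 * i.1) (j := 2 * i.1 - i.2.1) (by omega),
      rhoTilde_congr H (i := -(2 * i.1)) (j := 2 * i.1) (by omega),
      rhoTilde_congr H (i := -(2 * i.1 + 1)) (j := 2 * i.1 + 1) (by omega)]
    ring_nf
  · rintro ⟨i, rfl⟩; exact ⟨-i.1, by ring⟩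
  · ext <;> dsimp only <;> omega
  · rintro ⟨i, rfl⟩; exact ⟨-i.1 - 1, by ring⟩
  · ext <;> dsimp only <;> omega

theorem tsum_term12_12bc :
    ∑' i, term12_12bc H i = ∑' i, term12_12b H i + ∑' i, term12_12c H i := by
  rw [← (hasSum_term12_12b_add_term12_12c h1).tsum_eq,
    (summable_term12_12b h1).tsum_add (summable_term12_12c h1)]

theorem seriesConverge : SeriesConverge H :=
  ⟨summable_term11 h1, summable_term12 h1, summable_term1_11 h1, summable_term2_11 h1,
    summable_term1_22 h1, summable_term11_11 h1, (hasSum_term11_22 h1).summable,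
    summable_term11_12 h1, summable_term12_22 h1, summable_term12_12a h1,
    summable_term12_12b h1, summable_term12_12c h1⟩

end Parity

theorem cH_pos {H : ℝ} (h1 : H < 1) : 0 < cH H := by
  rw [cH, sub_pos]
  calc (2 : ℝ) ^ (2 * H) < 2 ^ (2 : ℝ) :=
        Real.rpow_lt_rpow_of_exponent_lt one_lt_two (by linarith)
    _ = 4 := by norm_num

theorem Sigma11_eq_tsum {H : ℝ} (h0 : 0 < H) (h1 : H < 1) :
    Sigma11 H = 2 / cH H ^ 2 * ∑' j, rhoHat H j ^ 2 := by
  have hs := (summable_term11 h1).hasSum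
  have hZ := HasSum.of_add_one_of_neg_add_one (f := fun j : ℤ => rhoHat H j ^ 2) hs
    (by simp only [rhoHat_neg]; exact hs)
  have := (cH_pos h1).ne'
  rw [hZ.tsum_eq, rhoHat_zero h0, Sigma11]
  field_simp
  ring

end Correlation

section Average

theorem tendsto_inv_mul_card_filter {p : ℕ → ℕ → Prop} [∀ n, DecidablePred (p n)] (m : ℕ)
    (hp : ∀ n b, m ≤ b → b + m ≤ n → p n b) :
    Tendsto (fun n : ℕ => (n : ℝ)⁻¹ * ((Finset.Ico 1 n).filter (p n)).card) atTop (𝓝 1) := by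
  have lower : Tendsto (fun n : ℕ => 1 - (2 * m + 1 : ℝ) / n) atTop (𝓝 1) := by
    simpa using (tendsto_const_div_atTop_nhds_zero_nat (2 * m + 1 : ℝ)).const_sub 1
  refine tendsto_of_tendsto_of_tendsto_of_le_of_le' lower tendsto_const_nhds ?_
    (Eventually.of_forall fun n => inv_mul_le_one_of_le₀ ?_ n.cast_nonneg)
  · filter_upwards [eventually_gt_atTop 0] with n hn
    have hn' : (0 : ℝ) < n := Nat.cast_pos.2 hn
    have hsub : Finset.Ico (m + 1) (n - m) ⊆ (Finset.Ico 1 n).filter (p n) := fun b hb => by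
      rw [Finset.mem_Ico] at hb
      exact Finset.mem_filter.2 ⟨Finset.mem_Ico.2 (by omega), hp n b (by omega) (by omega)⟩
    have hcard := Finset.card_le_card hsub
    rw [Nat.card_Ico] at hcard
    have : (n : ℝ) ≤ ((Finset.Ico 1 n).filter (p n)).card + (2 * m + 1) := by
      exact_mod_cast (by omega : n ≤ ((Finset.Ico 1 n).filter (p n)).card + (2 * m + 1))
    rw [le_inv_mul_iff₀ hn', mul_sub, mul_one, mul_div_cancel₀ _ hn'.ne']
    linarith
  · exact_mod_cast (Finset.card_filter_le _ _).trans (by simp)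

theorem sum_sum_comp_eq_tsum {ι X Y : Type*} [DecidableEq Y] {K : Y → ℝ} (hK : Summable K)
    (s : Finset ι) (S : Finset X) {ψ : ι → X → Y} (hψ : ∀ b, Function.Injective (ψ b)) :
    ∑ b ∈ s, ∑ x ∈ S, K (ψ b x) = ∑' y, (s.filter fun b => y ∈ S.image (ψ b)).card * K y := by
  have inner_sum : ∀ b, ∑ x ∈ S, K (ψ b x) = ∑' y, Set.indicator (S.image (ψ b)) K y := fun b => by
    rw [← sum_eq_tsum_indicator, Finset.sum_image fun x _ x' _ h => hψ b h]
  simp_rw [inner_sum]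
  rw [← Summable.tsum_finsetSum fun b _ => hK.indicator _]
  refine tsum_congr fun y => ?_
  simp only [Set.indicator_apply, Finset.mem_coe]
  rw [← Finset.sum_filter, Finset.sum_const, nsmul_eq_mul]

/-- Up to boundary effects, every `y` is hit by each of the `n - 1` translates, so its frequency
tends to `1` and dominated convergence applies. -/
theorem tendsto_average_translates {X Y : Type*} {K : Y → ℝ} (hK : Summable K)
    (S : ℕ → Finset X) (ψ : ℕ → X → Y) {F : ℕ → ℕ → X → ℝ}
    (hF : ∀ n, ∀ b ∈ Finset.Ico 1 n, ∀ x ∈ S n, F n b x = K (ψ b x))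
    (hψ : ∀ b, Function.Injective (ψ b))
    (hcov : ∀ y, ∃ m, ∀ n b, m ≤ b → b + m ≤ n → ∃ x ∈ S n, ψ b x = y) :
    Tendsto (fun n : ℕ => (n : ℝ)⁻¹ * ∑ b ∈ Finset.Ico 1 n, ∑ x ∈ S n, F n b x) atTop
      (𝓝 (∑' y, K y)) := by
  classical
  let freq : ℕ → Y → ℝ := fun n y =>
    (n : ℝ)⁻¹ * ((Finset.Ico 1 n).filter fun b => y ∈ (S n).image (ψ b)).card
  have freq_le : ∀ n y, freq n y ≤ 1 := fun n y => by
    refine inv_mul_le_one_of_le₀ ?_ n.cast_nonneg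
    exact_mod_cast (Finset.card_filter_le _ _).trans (by simp)
  have freq_tendsto : ∀ y, Tendsto (fun n => freq n y) atTop (𝓝 1) := fun y => by
    obtain ⟨m, hm⟩ := hcov y
    exact tendsto_inv_mul_card_filter m fun n b h h' => Finset.mem_image.2 (hm n b h h')
  have eq_tsum : ∀ n : ℕ, (n : ℝ)⁻¹ * ∑ b ∈ Finset.Ico 1 n, ∑ x ∈ S n, F n b x =
      ∑' y, freq n y * K y := fun n => by
    rw [Finset.sum_congr rfl fun b hb => Finset.sum_congr rfl (hF n b hb),
      sum_sum_comp_eq_tsum hK _ _ hψ, ← tsum_mul_left]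
    simp only [freq, mul_assoc]
  simp_rw [eq_tsum]
  refine tendsto_tsum_of_dominated_convergence hK.norm (fun y => ?_)
    (Eventually.of_forall fun n y => ?_)
  · simpa using (freq_tendsto y).mul_const (K y)
  · rw [norm_mul, Real.norm_of_nonneg (by positivity)]
    exact mul_le_of_le_one_left (norm_nonneg _) (freq_le n y)

theorem tendsto_average_translates₂ {X₁ X₂ Y : Type*} {K : Y → ℝ} (hK : Summable K)
    (S₁ : ℕ → Finset X₁) (S₂ : ℕ → Finset X₂) (ψ : ℕ → X₁ × X₂ → Y) {F : ℕ → ℕ → X₁ → X₂ → ℝ}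
    (hF : ∀ n, ∀ b ∈ Finset.Ico 1 n, ∀ j ∈ S₁ n, ∀ k ∈ S₂ n, F n b j k = K (ψ b (j, k)))
    (hψ : ∀ b, Function.Injective (ψ b))
    (hcov : ∀ y, ∃ m, ∀ n b, m ≤ b → b + m ≤ n → ∃ x ∈ S₁ n ×ˢ S₂ n, ψ b x = y) :
    Tendsto (fun n : ℕ => (n : ℝ)⁻¹ * ∑ b ∈ Finset.Ico 1 n, ∑ j ∈ S₁ n, ∑ k ∈ S₂ n, F n b j k)
      atTop (𝓝 (∑' y, K y)) := by
  refine (tendsto_average_translates hK (fun n => S₁ n ×ˢ S₂ n) ψ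
    (F := fun n b x => F n b x.1 x.2) (fun n b hb x hx => ?_) hψ hcov).congr fun n => ?_
  · exact hF n b hb _ (Finset.mem_product.1 hx).1 _ (Finset.mem_product.1 hx).2
  · simp only [Finset.sum_product]

theorem tendsto_average_translates₃ {X₁ X₂ X₃ Y : Type*} {K : Y → ℝ} (hK : Summable K)
    (S₁ : ℕ → Finset X₁) (S₂ : ℕ → Finset X₂) (S₃ : ℕ → Finset X₃) (ψ : ℕ → X₁ × X₂ × X₃ → Y)
    {F : ℕ → ℕ → X₁ → X₂ → X₃ → ℝ}
    (hF : ∀ n, ∀ b ∈ Finset.Ico 1 n, ∀ j ∈ S₁ n, ∀ k ∈ S₂ n, ∀ l ∈ S₃ n,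
      F n b j k l = K (ψ b (j, k, l)))
    (hψ : ∀ b, Function.Injective (ψ b))
    (hcov : ∀ y, ∃ m, ∀ n b, m ≤ b → b + m ≤ n → ∃ x ∈ S₁ n ×ˢ S₂ n ×ˢ S₃ n, ψ b x = y) :
    Tendsto (fun n : ℕ => (n : ℝ)⁻¹ *
      ∑ b ∈ Finset.Ico 1 n, ∑ j ∈ S₁ n, ∑ k ∈ S₂ n, ∑ l ∈ S₃ n, F n b j k l)
      atTop (𝓝 (∑' y, K y)) := by
  refine (tendsto_average_translates₂ hK S₁ (fun n => S₂ n ×ˢ S₃ n) ψ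
    (F := fun n b j x => F n b j x.1 x.2) (fun n b hb j hj x hx => ?_) hψ hcov).congr fun n => ?_
  · exact hF n b hb j hj _ (Finset.mem_product.1 hx).1 _ (Finset.mem_product.1 hx).2
  · simp only [Finset.sum_product]

theorem tendsto_inv_mul_comp_two_mul {X : ℕ → ℝ} {l : ℝ}
    (h : Tendsto (fun n : ℕ => (n : ℝ)⁻¹ * X n) atTop (𝓝 l)) :
    Tendsto (fun n : ℕ => (n : ℝ)⁻¹ * X (2 * n)) atTop (𝓝 (2 * l)) := by
  refine ((h.comp (tendsto_id.const_mul_atTop' two_pos)).const_mul 2).congr fun n => ?_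
  simp only [Function.comp_apply, id, Nat.cast_mul, Nat.cast_two, mul_inv]
  ring

end Average

section SecondDifferences

variable {H : Set.Ioo (0 : ℝ) 1} {T : ℝ}

theorem inner_ind_grid (hT : 0 < T) {m : ℕ} (hm : 0 < m) {x y : ℝ} (hx : x ∈ Set.Icc (0 : ℝ) m)
    (hy : y ∈ Set.Icc (0 : ℝ) m) :
    ⟪ind H T (grid T m x), ind H T (grid T m y)⟫_ℝ =
      (grid T m x ^ (2 * (H : ℝ)) + grid T m y ^ (2 * (H : ℝ))
        - (T / m) ^ (2 * (H : ℝ)) * |x - y| ^ (2 * (H : ℝ))) / 2 := by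
  have hm' : (0 : ℝ) < m := Nat.cast_pos.2 hm
  have grid_mem : ∀ z ∈ Set.Icc (0 : ℝ) m, grid T m z ∈ Set.Icc 0 T := fun z hz => by
    refine ⟨div_nonneg (mul_nonneg hz.1 hT.le) hm'.le, ?_⟩
    rw [grid, div_le_iff₀ hm', mul_comm]
    exact mul_le_mul_of_nonneg_left hz.2 hT.le
  have abs_grid_sub : |grid T m x - grid T m y| = T / m * |x - y| := by
    rw [← abs_of_pos (div_pos hT hm'), ← abs_mul, grid, grid]
    congr 1
    ring
  rw [inner_ind H (grid_mem y hy) (grid_mem x hx), covKernel, abs_grid_sub,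
    Real.mul_rpow (by positivity) (abs_nonneg _)]

theorem inner_stepDiff (hT : 0 < T) {m i j : ℕ} (hi : i ∈ Finset.Ico 1 m)
    (hj : j ∈ Finset.Ico 1 m) :
    ⟪stepDiff H T m i, stepDiff H T m j⟫_ℝ = (T / m) ^ (2 * (H : ℝ)) * rhoHat H (i - j) := by
  rw [Finset.mem_Ico] at hi hj
  have hm : 0 < m := by omega
  have neighbours_mem : ∀ k : ℕ, 1 ≤ k ∧ k < m → (k : ℝ) + 1 ∈ Set.Icc (0 : ℝ) m ∧
      (k : ℝ) ∈ Set.Icc (0 : ℝ) m ∧ (k : ℝ) - 1 ∈ Set.Icc (0 : ℝ) m := fun k hk => by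
    have h1 : (1 : ℝ) ≤ k := by exact_mod_cast hk.1
    have h2 : (k : ℝ) + 1 ≤ m := by exact_mod_cast hk.2
    refine ⟨⟨?_, ?_⟩, ⟨?_, ?_⟩, ⟨?_, ?_⟩⟩ <;> linarith
  obtain ⟨i1, i2, i3⟩ := neighbours_mem i hi
  obtain ⟨j1, j2, j3⟩ := neighbours_mem j hj
  simp only [stepDiff, inner_sub_left, inner_sub_right]
  rw [inner_ind_grid hT hm i1 j1, inner_ind_grid hT hm i1 j2, inner_ind_grid hT hm i1 j3,
    inner_ind_grid hT hm i2 j1, inner_ind_grid hT hm i2 j2, inner_ind_grid hT hm i2 j3,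
    inner_ind_grid hT hm i3 j1, inner_ind_grid hT hm i3 j2, inner_ind_grid hT hm i3 j3, rhoHat]
  push_cast
  ring_nf

theorem stepDiff_eq {n i : ℕ} (hi : 1 ≤ i) :
    stepDiff H T n i = stepDiff H T (2 * n) (2 * i + 1) + (2 : ℝ) • stepDiff H T (2 * n) (2 * i)
      + stepDiff H T (2 * n) (2 * i - 1) := by
  have grid_two_mul : ∀ x : ℝ, grid T n x = grid T (2 * n) (2 * x) := fun x => by
    rw [grid, grid, Nat.cast_mul, Nat.cast_two, mul_assoc, mul_div_mul_left _ _ two_ne_zero]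
  have cast_pred : ((2 * i - 1 : ℕ) : ℝ) = 2 * i - 1 := by
    rw [Nat.cast_sub (by omega), Nat.cast_mul, Nat.cast_two, Nat.cast_one]
  simp only [stepDiff, grid_two_mul, cast_pred, Nat.cast_add, Nat.cast_mul, Nat.cast_two,
    Nat.cast_one]
  ring_nf
  module

/-- The second difference of the indicators on the grid of mesh `T / m`, rescaled by the
self-similarity factor `(T / m)⁻ᴴ` so that its Gram matrix no longer depends on `T` and `m`. -/
noncomputable def scaledDiff (H : Set.Ioo (0 : ℝ) 1) (T : ℝ) (m j : ℕ) : CMSpace H T :=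
  ((T / m) ^ (H : ℝ))⁻¹ • stepDiff H T m j

theorem inner_scaledDiff (hT : 0 < T) {m i j : ℕ} (hi : i ∈ Finset.Ico 1 m)
    (hj : j ∈ Finset.Ico 1 m) :
    ⟪scaledDiff H T m i, scaledDiff H T m j⟫_ℝ = rhoHat H (i - j) := by
  have hm : (0 : ℝ) < m := by rw [Finset.mem_Ico] at hi; exact_mod_cast (by omega : 0 < m)
  rw [scaledDiff, scaledDiff, real_inner_smul_left, real_inner_smul_right, inner_stepDiff hT hi hj,
    two_mul, Real.rpow_add (by positivity)]
  field_simp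

theorem scaledDiff_eq (hT : 0 ≤ T) {n i : ℕ} (hi : 1 ≤ i) :
    scaledDiff H T n i = ((2 : ℝ) ^ (H : ℝ))⁻¹ • (scaledDiff H T (2 * n) (2 * i + 1)
      + (2 : ℝ) • scaledDiff H T (2 * n) (2 * i) + scaledDiff H T (2 * n) (2 * i - 1)) := by
  have mesh_eq : T / n = 2 * (T / (2 * n : ℕ)) := by
    rw [Nat.cast_mul, Nat.cast_two, mul_div_assoc', mul_div_mul_left _ _ two_ne_zero]
  simp only [scaledDiff]
  rw [stepDiff_eq hi, mesh_eq, Real.mul_rpow two_pos.le (by positivity)]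
  module

theorem inner_scaledDiff_two_mul (hT : 0 < T) {n i j : ℕ} (hi : i ∈ Finset.Ico 1 n)
    (hj : j ∈ Finset.Ico 1 (2 * n)) :
    ⟪scaledDiff H T n i, scaledDiff H T (2 * n) j⟫_ℝ = 2 ^ (H : ℝ) * rhoTilde H (2 * i - j) := by
  have hi' := Finset.mem_Ico.1 hi
  rw [scaledDiff_eq hT.le hi'.1, real_inner_smul_left, inner_add_left, inner_add_left,
    real_inner_smul_left, inner_scaledDiff hT (Finset.mem_Ico.2 ⟨by omega, by omega⟩) hj,
    inner_scaledDiff hT (Finset.mem_Ico.2 ⟨by omega, by omega⟩) hj,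
    inner_scaledDiff hT (Finset.mem_Ico.2 ⟨by omega, by omega⟩) hj, rhoTilde_eq, two_mul (H : ℝ),
    Real.rpow_add two_pos, show ((2 * i + 1 : ℕ) : ℤ) - j = 2 * (i : ℤ) - j + 1 by push_cast; ring,
    show ((2 * i - 1 : ℕ) : ℤ) - j = 2 * (i : ℤ) - j - 1 by omega,
    show ((2 * i : ℕ) : ℤ) - j = 2 * (i : ℤ) - j by push_cast; ring]
  field_simp

theorem sum_abs_inner_scaledDiff_le (hT : 0 < T) {m i : ℕ} (hi : i ∈ Finset.Ico 1 m) :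
    ∑ j ∈ Finset.Ico 1 m, |⟪scaledDiff H T m i, scaledDiff H T m j⟫_ℝ| ≤
      ∑' j, |rhoHat H j| := by
  have hinj : Function.Injective fun j : ℕ => (i : ℤ) - j := fun a b h => by grind
  rw [Finset.sum_congr rfl fun j hj => by rw [inner_scaledDiff hT hi hj],
    ← Finset.sum_image (f := fun k : ℤ => |rhoHat H k|) fun a _ b _ h => hinj h]
  exact (summable_rhoHat H.2.2).abs.sum_le_tsum _ fun _ _ => abs_nonneg _

/-- The kernel `∑ⱼ vⱼ ⊗ vⱼ` of the centered quadratic variation of the rescaled second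
differences `vⱼ`. -/
noncomputable def diffKernel (H : Set.Ioo (0 : ℝ) 1) (T : ℝ) (m : ℕ) :
    CMSpace H T ⊗[ℝ] CMSpace H T :=
  ∑ j ∈ Finset.Ico 1 m, scaledDiff H T m j ⊗ₜ[ℝ] scaledDiff H T m j

theorem comm_diffKernel (m : ℕ) :
    TensorProduct.comm ℝ _ _ (diffKernel H T m) = diffKernel H T m :=
  comm_sum_tmul_self _ _

theorem inner_diffKernel_tmul_self_le (hT : 0 < T) (m : ℕ) {e : CMSpace H T} (he : ‖e‖ = 1) :
    |⟪diffKernel H T m, e ⊗ₜ[ℝ] e⟫_ℝ| ≤ ∑' j, |rhoHat H j| := by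
  have h := sum_inner_sq_le (tsum_nonneg fun j => abs_nonneg (rhoHat H j))
    (fun i hi => sum_abs_inner_scaledDiff_le (m := m) hT hi) e
  rw [he, one_pow, mul_one] at h
  rw [diffKernel, sum_inner]
  simp only [TensorProduct.inner_tmul, ← sq]
  rwa [abs_of_nonneg (Finset.sum_nonneg fun _ _ => sq_nonneg _)]

end SecondDifferences

section DiffKernelLimits

variable {H : Set.Ioo (0 : ℝ) 1} {T : ℝ}

local notation "D" => diffKernel H T

theorem tendsto_inner_coarse_coarse (hT : 0 < T) :
    Tendsto (fun n : ℕ => (n : ℝ)⁻¹ * ⟪D n, D n⟫_ℝ) atTop (𝓝 (∑' j, rhoHat H j ^ 2)) := by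
  simp only [diffKernel, inner_sum_tmul_self]
  refine tendsto_average_translates (summable_rhoHat_sq H.2.2) (fun n => Finset.Ico 1 n)
    (fun b x => (b : ℤ) - x) (fun n b hb x hx => ?_) (fun b x y h => by grind) (fun y => ?_)
  · rw [inner_scaledDiff hT hb hx]
  · refine ⟨y.natAbs + 2, fun n b h1 h2 => ⟨(b - y).toNat, ?_, ?_⟩⟩ <;> simp <;> omega

theorem tendsto_inner_coarse_fine (hT : 0 < T) :
    Tendsto (fun n : ℕ => (n : ℝ)⁻¹ * ⟪D n, D (2 * n)⟫_ℝ) atTop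
      (𝓝 ((2 ^ (H : ℝ)) ^ 2 * ∑' j, term12 H j)) := by
  simp only [diffKernel, inner_sum_tmul_self]
  rw [← tsum_mul_left]
  refine tendsto_average_translates ((summable_term12 H.2.2).mul_left _)
    (fun n => Finset.Ico 1 (2 * n)) (fun b x => 2 * (b : ℤ) - x) (fun n b hb x hx => ?_)
    (fun b x y h => by grind) (fun y => ?_)
  · rw [inner_scaledDiff_two_mul hT hb hx, mul_pow, term12]
  · refine ⟨y.natAbs + 2, fun n b h1 h2 => ⟨(2 * b - y).toNat, ?_, ?_⟩⟩ <;> simp <;> omega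

theorem tendsto_inner_coarse_contrₗ_coarse_coarse (hT : 0 < T) :
    Tendsto (fun n : ℕ => (n : ℝ)⁻¹ * ⟪D n, contrₗ (D n) (D n)⟫_ℝ) atTop
      (𝓝 (∑' i, term1_11 H i)) := by
  simp only [diffKernel, inner_sum_contrₗ_sum]
  refine tendsto_average_translates₂ (summable_term1_11 H.2.2) (fun n => Finset.Ico 1 n)
    (fun n => Finset.Ico 1 n) (fun b x => ((x.1 : ℤ) - b, (x.2 : ℤ) - b))
    (fun n b hb j hj k hk => ?_) (fun b x y h => by grind) (fun ⟨y₁, y₂⟩ => ?_)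
  · rw [inner_scaledDiff hT hb hj, inner_scaledDiff hT hj hk, inner_scaledDiff hT hb hk, term1_11,
      rhoHat_congr H (i := j - b) (j := b - j) (by omega),
      rhoHat_congr H (i := j - b - (k - b)) (j := j - k) (by omega),
      rhoHat_congr H (i := k - b) (j := b - k) (by omega)]
  · refine ⟨y₁.natAbs + y₂.natAbs + 2, fun n b h1 h2 => ⟨((y₁ + b).toNat, (y₂ + b).toNat), ?_, ?_⟩⟩
      <;> simp <;> omega

theorem tendsto_inner_coarse_contrₗ_coarse_fine (hT : 0 < T) :
    Tendsto (fun n : ℕ => (n : ℝ)⁻¹ * ⟪D n, contrₗ (D n) (D (2 * n))⟫_ℝ) atTop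
      (𝓝 ((2 ^ (H : ℝ)) ^ 2 * ∑' i, term2_11 H i)) := by
  simp only [diffKernel, inner_sum_contrₗ_sum]
  rw [← tsum_mul_left]
  refine tendsto_average_translates₂ ((summable_term2_11 H.2.2).mul_left _)
    (fun n => Finset.Ico 1 n) (fun n => Finset.Ico 1 (2 * n))
    (fun b x => ((x.1 : ℤ) - b, (x.2 : ℤ) - 2 * b))
    (fun n b hb j hj k hk => ?_) (fun b x y h => by grind) (fun ⟨y₁, y₂⟩ => ?_)
  · rw [inner_scaledDiff hT hb hj, inner_scaledDiff_two_mul hT hj hk,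
      inner_scaledDiff_two_mul hT hb hk, term2_11,
      rhoHat_congr H (i := j - b) (j := b - j) (by omega),
      rhoTilde_congr H (i := k - 2 * b - 2 * (j - b)) (j := 2 * j - k) (by omega),
      rhoTilde_congr H (i := k - 2 * b) (j := 2 * b - k) (by omega)]
    ring
  · refine ⟨y₁.natAbs + y₂.natAbs + 2,
      fun n b h1 h2 => ⟨((y₁ + b).toNat, (y₂ + 2 * b).toNat), ?_, ?_⟩⟩ <;> simp <;> omega

theorem tendsto_inner_coarse_contrₗ_fine_fine (hT : 0 < T) :
    Tendsto (fun n : ℕ => (n : ℝ)⁻¹ * ⟪D n, contrₗ (D (2 * n)) (D (2 * n))⟫_ℝ) atTop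
      (𝓝 ((2 ^ (H : ℝ)) ^ 2 * ∑' i, term1_22 H i)) := by
  simp only [diffKernel, inner_sum_contrₗ_sum]
  rw [← tsum_mul_left]
  refine tendsto_average_translates₂ ((summable_term1_22 H.2.2).mul_left _)
    (fun n => Finset.Ico 1 (2 * n)) (fun n => Finset.Ico 1 (2 * n))
    (fun b x => ((x.2 : ℤ) - x.1, 2 * (b : ℤ) - x.1))
    (fun n b hb j hj k hk => ?_) (fun b x y h => by grind) (fun ⟨y₁, y₂⟩ => ?_)
  · rw [inner_scaledDiff_two_mul hT hb hj, inner_scaledDiff hT hj hk,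
      inner_scaledDiff_two_mul hT hb hk, term1_22,
      rhoHat_congr H (i := k - j) (j := j - k) (by omega),
      rhoTilde_congr H (i := k - j - (2 * b - j)) (j := 2 * b - k) (by omega)]
    ring
  · refine ⟨y₁.natAbs + y₂.natAbs + 2,
      fun n b h1 h2 => ⟨((2 * b - y₂).toNat, (2 * b - y₂ + y₁).toNat), ?_, ?_⟩⟩ <;> simp <;> omega

theorem tendsto_inner_contrₗ_coarse_coarse_contrₗ_coarse_coarse (hT : 0 < T) :
    Tendsto (fun n : ℕ => (n : ℝ)⁻¹ * ⟪contrₗ (D n) (D n), contrₗ (D n) (D n)⟫_ℝ) atTop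
      (𝓝 (∑' i, term11_11 H i)) := by
  simp only [diffKernel, inner_contrₗ_sum_contrₗ_sum]
  refine tendsto_average_translates₃ (summable_term11_11 H.2.2) (fun n => Finset.Ico 1 n)
    (fun n => Finset.Ico 1 n) (fun n => Finset.Ico 1 n)
    (fun b x => ((x.1 : ℤ) - b, (x.2.2 : ℤ) - b, (x.2.1 : ℤ) - b))
    (fun n b hb j hj k hk l hl => ?_) (fun b x y h => by grind) (fun ⟨y₁, y₂, y₃⟩ => ?_)
  · rw [inner_scaledDiff hT hb hj, inner_scaledDiff hT hk hl, inner_scaledDiff hT hb hk,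
      inner_scaledDiff hT hj hl, term11_11,
      rhoHat_congr H (i := j - b) (j := b - j) (by omega),
      rhoHat_congr H (i := j - b - (l - b)) (j := j - l) (by omega),
      rhoHat_congr H (i := l - b - (k - b)) (j := k - l) (by omega),
      rhoHat_congr H (i := k - b) (j := b - k) (by omega)]
    ring
  · refine ⟨y₁.natAbs + y₂.natAbs + y₃.natAbs + 2, fun n b h1 h2 =>
      ⟨((y₁ + b).toNat, (y₃ + b).toNat, (y₂ + b).toNat), ?_, ?_⟩⟩ <;> simp <;> omega

theorem tendsto_inner_contrₗ_coarse_coarse_contrₗ_coarse_fine (hT : 0 < T) :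
    Tendsto (fun n : ℕ => (n : ℝ)⁻¹ * ⟪contrₗ (D n) (D n), contrₗ (D n) (D (2 * n))⟫_ℝ) atTop
      (𝓝 ((2 ^ (H : ℝ)) ^ 2 * ∑' i, term11_12 H i)) := by
  simp only [diffKernel, inner_contrₗ_sum_contrₗ_sum]
  rw [← tsum_mul_left]
  refine tendsto_average_translates₃ ((summable_term11_12 H.2.2).mul_left _)
    (fun n => Finset.Ico 1 n) (fun n => Finset.Ico 1 n) (fun n => Finset.Ico 1 (2 * n))
    (fun b x => ((x.1 : ℤ) - b, (x.2.2 : ℤ) - 2 * b, (x.2.1 : ℤ) - b))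
    (fun n b hb j hj k hk l hl => ?_) (fun b x y h => by grind) (fun ⟨y₁, y₂, y₃⟩ => ?_)
  · rw [inner_scaledDiff hT hb hj, inner_scaledDiff_two_mul hT hk hl, inner_scaledDiff hT hb hk,
      inner_scaledDiff_two_mul hT hj hl, term11_12,
      rhoHat_congr H (i := j - b) (j := b - j) (by omega),
      rhoTilde_congr H (i := 2 * (j - b) - (l - 2 * b)) (j := 2 * j - l) (by omega),
      rhoTilde_congr H (i := l - 2 * b - 2 * (k - b)) (j := 2 * k - l) (by omega),
      rhoHat_congr H (i := k - b) (j := b - k) (by omega)]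
    ring
  · refine ⟨y₁.natAbs + y₂.natAbs + y₃.natAbs + 2, fun n b h1 h2 =>
      ⟨((y₁ + b).toNat, (y₃ + b).toNat, (y₂ + 2 * b).toNat), ?_, ?_⟩⟩ <;> simp <;> omega

theorem tendsto_inner_contrₗ_coarse_coarse_contrₗ_fine_fine (hT : 0 < T) :
    Tendsto (fun n : ℕ =>
        (n : ℝ)⁻¹ * ⟪contrₗ (D n) (D n), contrₗ (D (2 * n)) (D (2 * n))⟫_ℝ) atTop
      (𝓝 ((2 ^ (H : ℝ)) ^ 2 * ∑' i, term12_12a H i)) := by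
  simp only [diffKernel, inner_contrₗ_sum_contrₗ_sum]
  rw [← tsum_mul_left]
  refine tendsto_average_translates₃ ((summable_term12_12a H.2.2).mul_left _)
    (fun n => Finset.Ico 1 n) (fun n => Finset.Ico 1 (2 * n)) (fun n => Finset.Ico 1 (2 * n))
    (fun b x => ((x.1 : ℤ) - b, (x.2.2 : ℤ) - 2 * b, (x.2.1 : ℤ) - 2 * b))
    (fun n b hb j hj k hk l hl => ?_) (fun b x y h => by grind) (fun ⟨y₁, y₂, y₃⟩ => ?_)
  · rw [inner_scaledDiff hT hb hj, inner_scaledDiff hT hk hl, inner_scaledDiff_two_mul hT hb hk,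
      inner_scaledDiff_two_mul hT hj hl, term12_12a,
      rhoHat_congr H (i := j - b) (j := b - j) (by omega),
      rhoTilde_congr H (i := 2 * (j - b) - (l - 2 * b)) (j := 2 * j - l) (by omega),
      rhoHat_congr H (i := l - 2 * b - (k - 2 * b)) (j := k - l) (by omega),
      rhoTilde_congr H (i := k - 2 * b) (j := 2 * b - k) (by omega)]
    ring
  · refine ⟨y₁.natAbs + y₂.natAbs + y₃.natAbs + 2, fun n b h1 h2 =>
      ⟨((y₁ + b).toNat, (y₃ + 2 * b).toNat, (y₂ + 2 * b).toNat), ?_, ?_⟩⟩ <;> simp <;> omega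

theorem tendsto_inner_contrₗ_coarse_fine_contrₗ_fine_coarse (hT : 0 < T) :
    Tendsto (fun n : ℕ =>
        (n : ℝ)⁻¹ * ⟪contrₗ (D n) (D (2 * n)), contrₗ (D (2 * n)) (D n)⟫_ℝ) atTop
      (𝓝 ((2 ^ (H : ℝ)) ^ 4 * ∑' i, term12_12bc H i)) := by
  simp only [diffKernel, inner_contrₗ_sum_contrₗ_sum]
  rw [← tsum_mul_left]
  refine tendsto_average_translates₃ ((summable_term12_12bc H.2.2).mul_left _)
    (fun n => Finset.Ico 1 (2 * n)) (fun n => Finset.Ico 1 (2 * n)) (fun n => Finset.Ico 1 n)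
    (fun b x => ((x.1 : ℤ) - 2 * b, (x.2.2 : ℤ) - b, (x.2.1 : ℤ) - 2 * b))
    (fun n b hb j hj k hk l hl => ?_) (fun b x y h => by grind) (fun ⟨y₁, y₂, y₃⟩ => ?_)
  · rw [inner_scaledDiff_two_mul hT hb hj, inner_scaledDiff_two_mul hT hb hk,
      real_inner_comm (scaledDiff H T n l) (scaledDiff H T (2 * n) k),
      real_inner_comm (scaledDiff H T n l) (scaledDiff H T (2 * n) j),
      inner_scaledDiff_two_mul hT hl hk, inner_scaledDiff_two_mul hT hl hj, term12_12bc,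
      rhoTilde_congr H (i := j - 2 * b) (j := 2 * b - j) (by omega),
      rhoTilde_congr H (i := 2 * (l - b) - (j - 2 * b)) (j := 2 * l - j) (by omega),
      rhoTilde_congr H (i := k - 2 * b - 2 * (l - b)) (j := 2 * l - k) (by omega),
      rhoTilde_congr H (i := k - 2 * b) (j := 2 * b - k) (by omega)]
    ring
  · refine ⟨y₁.natAbs + y₂.natAbs + y₃.natAbs + 2, fun n b h1 h2 =>
      ⟨((y₁ + 2 * b).toNat, (y₃ + 2 * b).toNat, (y₂ + b).toNat), ?_, ?_⟩⟩ <;> simp <;> omega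

theorem tendsto_inner_contrₗ_coarse_fine_contrₗ_fine_fine (hT : 0 < T) :
    Tendsto (fun n : ℕ =>
        (n : ℝ)⁻¹ * ⟪contrₗ (D n) (D (2 * n)), contrₗ (D (2 * n)) (D (2 * n))⟫_ℝ) atTop
      (𝓝 ((2 ^ (H : ℝ)) ^ 2 * ∑' i, term12_22 H i)) := by
  simp only [diffKernel, inner_contrₗ_sum_contrₗ_sum]
  rw [← tsum_mul_left]
  refine tendsto_average_translates₃ ((summable_term12_22 H.2.2).mul_left _)
    (fun n => Finset.Ico 1 (2 * n)) (fun n => Finset.Ico 1 (2 * n))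
    (fun n => Finset.Ico 1 (2 * n))
    (fun b x => ((x.2.2 : ℤ) - x.1, (x.2.1 : ℤ) - x.1, 2 * (b : ℤ) - x.1))
    (fun n b hb j hj k hk l hl => ?_) (fun b x y h => by grind) (fun ⟨y₁, y₂, y₃⟩ => ?_)
  · rw [inner_scaledDiff_two_mul hT hb hj, inner_scaledDiff hT hk hl,
      inner_scaledDiff_two_mul hT hb hk, inner_scaledDiff hT hj hl, term12_22,
      rhoHat_congr H (i := l - j) (j := j - l) (by omega),
      rhoHat_congr H (i := l - j - (k - j)) (j := k - l) (by omega),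
      rhoTilde_congr H (i := k - j - (2 * b - j)) (j := 2 * b - k) (by omega)]
    ring
  · refine ⟨y₁.natAbs + y₂.natAbs + y₃.natAbs + 2, fun n b h1 h2 =>
      ⟨((2 * b - y₃).toNat, (2 * b - y₃ + y₂).toNat, (2 * b - y₃ + y₁).toNat), ?_, ?_⟩⟩
      <;> simp <;> omega

end DiffKernelLimits

section Polynomials

variable {H : Set.Ioo (0 : ℝ) 1} {T : ℝ} {p q : ℕ → ℝ} {p₀ q₀ : ℝ}

theorem tendsto_inner_sub_smul_diffKernel (hT : 0 < T) (hp : Tendsto p atTop (𝓝 p₀))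
    (hq : Tendsto q atTop (𝓝 q₀)) :
    Tendsto (fun n : ℕ => (n : ℝ)⁻¹ *
        ⟪p n • diffKernel H T n - q n • diffKernel H T (2 * n),
          p n • diffKernel H T n - q n • diffKernel H T (2 * n)⟫_ℝ) atTop
      (𝓝 (p₀ ^ 2 * (∑' j, rhoHat H j ^ 2)
        - 2 * p₀ * q₀ * ((2 ^ (H : ℝ)) ^ 2 * ∑' j, term12 H j)
        + q₀ ^ 2 * (2 * ∑' j, rhoHat H j ^ 2))) := by
  have fine := tendsto_inv_mul_comp_two_mul
    (X := fun m => ⟪diffKernel H T m, diffKernel H T m⟫_ℝ) (tendsto_inner_coarse_coarse hT)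
  refine ((((hp.pow 2).mul (tendsto_inner_coarse_coarse hT)).sub
    (((hp.const_mul 2).mul hq).mul (tendsto_inner_coarse_fine hT))).add
    ((hq.pow 2).mul fine)).congr fun n => ?_
  rw [inner_sub_smul_self]
  ring

theorem tendsto_inner_contrₗ_sub_smul_diffKernel (hT : 0 < T) (hp : Tendsto p atTop (𝓝 p₀))
    (hq : Tendsto q atTop (𝓝 q₀)) :
    Tendsto (fun n : ℕ => (n : ℝ)⁻¹ *
        ⟪p n • diffKernel H T n - q n • diffKernel H T (2 * n),
          contrₗ (p n • diffKernel H T n - q n • diffKernel H T (2 * n))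
            (p n • diffKernel H T n - q n • diffKernel H T (2 * n))⟫_ℝ) atTop
      (𝓝 (p₀ ^ 3 * (∑' i, term1_11 H i)
        - 3 * p₀ ^ 2 * q₀ * ((2 ^ (H : ℝ)) ^ 2 * ∑' i, term2_11 H i)
        + 3 * p₀ * q₀ ^ 2 * ((2 ^ (H : ℝ)) ^ 2 * ∑' i, term1_22 H i)
        - q₀ ^ 3 * (2 * ∑' i, term1_11 H i))) := by
  have fine := tendsto_inv_mul_comp_two_mul
    (X := fun m => ⟪diffKernel H T m, contrₗ (diffKernel H T m) (diffKernel H T m)⟫_ℝ)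
    (tendsto_inner_coarse_contrₗ_coarse_coarse hT)
  refine (((((hp.pow 3).mul (tendsto_inner_coarse_contrₗ_coarse_coarse hT)).sub
    ((((hp.pow 2).const_mul 3).mul hq).mul (tendsto_inner_coarse_contrₗ_coarse_fine hT))).add
    (((hp.const_mul 3).mul (hq.pow 2)).mul (tendsto_inner_coarse_contrₗ_fine_fine hT))).sub
    ((hq.pow 3).mul fine)).congr fun n => ?_
  rw [inner_sub_smul_contrₗ (comm_diffKernel _) (comm_diffKernel _)]
  ring

theorem tendsto_inner_contrₗ_self_sub_smul_diffKernel (hT : 0 < T)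
    (hp : Tendsto p atTop (𝓝 p₀)) (hq : Tendsto q atTop (𝓝 q₀)) :
    Tendsto (fun n : ℕ => (n : ℝ)⁻¹ *
        ⟪contrₗ (p n • diffKernel H T n - q n • diffKernel H T (2 * n))
            (p n • diffKernel H T n - q n • diffKernel H T (2 * n)),
          contrₗ (p n • diffKernel H T n - q n • diffKernel H T (2 * n))
            (p n • diffKernel H T n - q n • diffKernel H T (2 * n))⟫_ℝ) atTop
      (𝓝 (p₀ ^ 4 * (∑' i, term11_11 H i)
        - 4 * p₀ ^ 3 * q₀ * ((2 ^ (H : ℝ)) ^ 2 * ∑' i, term11_12 H i)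
        + p₀ ^ 2 * q₀ ^ 2 * (4 * ((2 ^ (H : ℝ)) ^ 2 * ∑' i, term12_12a H i)
          + 2 * ((2 ^ (H : ℝ)) ^ 4 * ∑' i, term12_12bc H i))
        - 4 * p₀ * q₀ ^ 3 * ((2 ^ (H : ℝ)) ^ 2 * ∑' i, term12_22 H i)
        + q₀ ^ 4 * (2 * ∑' i, term11_11 H i))) := by
  have fine := tendsto_inv_mul_comp_two_mul
    (X := fun m => ⟪contrₗ (diffKernel H T m) (diffKernel H T m),
      contrₗ (diffKernel H T m) (diffKernel H T m)⟫_ℝ)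
    (tendsto_inner_contrₗ_coarse_coarse_contrₗ_coarse_coarse hT)
  have coarse := tendsto_inner_contrₗ_coarse_coarse_contrₗ_coarse_coarse (H := H) hT
  have mixed₁ := tendsto_inner_contrₗ_coarse_coarse_contrₗ_coarse_fine (H := H) hT
  have mixed₂ := ((tendsto_inner_contrₗ_coarse_coarse_contrₗ_fine_fine (H := H) hT).const_mul 4).add
    ((tendsto_inner_contrₗ_coarse_fine_contrₗ_fine_coarse (H := H) hT).const_mul 2)
  have mixed₃ := tendsto_inner_contrₗ_coarse_fine_contrₗ_fine_fine (H := H) hT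
  refine ((((((hp.pow 4).mul coarse).sub ((((hp.pow 3).const_mul 4).mul hq).mul mixed₁)).add
    (((hp.pow 2).mul (hq.pow 2)).mul mixed₂)).sub
    (((hp.const_mul 4).mul (hq.pow 3)).mul mixed₃)).add ((hq.pow 4).mul fine)).congr fun n => ?_
  rw [inner_contrₗ_sub_smul_self (comm_diffKernel _) (comm_diffKernel _)]
  ring

end Polynomials

section LimitMatrix

theorem matT_zero_zero (H : ℝ) : matT H 0 0 = Sigma22 H - 2 * Sigma12 H + Sigma11 H := by
  simp only [matT, matU, Matrix.of_apply, Matrix.cons_val', Matrix.cons_val_zero,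
    Matrix.cons_val_one, Matrix.cons_val_fin_one]
  ring

theorem matT_zero_zero_eq_tsum {H : ℝ} (h0 : 0 < H) (h1 : H < 1) :
    matT H 0 0 = 2 * ((cH H)⁻¹ ^ 2 * (∑' j, rhoHat H j ^ 2)
      - 2 * (cH H)⁻¹ * (2 * cH H)⁻¹ * ((2 ^ H) ^ 2 * ∑' j, term12 H j)
      + (2 * cH H)⁻¹ ^ 2 * (2 * ∑' j, rhoHat H j ^ 2)) := by
  have hc := (cH_pos h1).ne'
  rw [matT_zero_zero, Sigma22, Sigma11_eq_tsum h0 h1, Sigma12, two_mul H, Real.rpow_add two_pos]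
  field_simp
  ring

theorem matT_zero_one_eq_tsum {H : ℝ} (h1 : H < 1) :
    matT H 0 1 = 4 * ((cH H)⁻¹ ^ 3 * (∑' i, term1_11 H i)
      - 3 * (cH H)⁻¹ ^ 2 * (2 * cH H)⁻¹ * ((2 ^ H) ^ 2 * ∑' i, term2_11 H i)
      + 3 * (cH H)⁻¹ * (2 * cH H)⁻¹ ^ 2 * ((2 ^ H) ^ 2 * ∑' i, term1_22 H i)
      - (2 * cH H)⁻¹ ^ 3 * (2 * ∑' i, term1_11 H i)) := by
  have hc := (cH_pos h1).ne'
  have h4 : (2 : ℝ) ^ (2 : ℝ) = 4 := by norm_num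
  have e : matT H 0 1 = U13 H - U23 H := by simp [matT, matU]
  rw [e]
  simp only [U13, U23, kappa1_12, kappa2_12, kappa2_22, kappa1_11, kappa2_11, kappa1_22]
  rw [Real.rpow_sub two_pos, Real.rpow_sub two_pos, two_mul H, Real.rpow_add two_pos, h4,
    Real.rpow_one]
  field_simp
  ring

theorem matT_one_one_eq_tsum {H : ℝ} (h1 : H < 1) :
    matT H 1 1 = 8 * ((cH H)⁻¹ ^ 4 * (∑' i, term11_11 H i)
      - 4 * (cH H)⁻¹ ^ 3 * (2 * cH H)⁻¹ * ((2 ^ H) ^ 2 * ∑' i, term11_12 H i)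
      + (cH H)⁻¹ ^ 2 * (2 * cH H)⁻¹ ^ 2 * (4 * ((2 ^ H) ^ 2 * ∑' i, term12_12a H i)
        + 2 * ((2 ^ H) ^ 4 * ∑' i, term12_12bc H i))
      - 4 * (cH H)⁻¹ * (2 * cH H)⁻¹ ^ 3 * ((2 ^ H) ^ 2 * ∑' i, term12_22 H i)
      + (2 * cH H)⁻¹ ^ 4 * (2 * ∑' i, term11_11 H i)) := by
  have hc := (cH_pos h1).ne'
  have h4 : (2 : ℝ) ^ (2 : ℝ) = 4 := by norm_num
  have h8 : (2 : ℝ) ^ (3 : ℝ) = 8 := by norm_num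
  have e : matT H 1 1 = U33 H := by simp [matT, matU]
  rw [e]
  simp only [U33, kappa22_22, kappa12_12, kappa11_11, kappa12_22, kappa11_22, kappa11_12]
  rw [(hasSum_term11_22 h1).tsum_eq, tsum_term12_12bc h1, Real.rpow_sub two_pos,
    Real.rpow_sub two_pos, Real.rpow_sub two_pos, Real.rpow_sub two_pos,
    show 4 * H = H + H + (H + H) by ring, two_mul H, Real.rpow_add two_pos (H + H),
    Real.rpow_add two_pos H, h4, h8, Real.rpow_one]
  field_simp
  ring

theorem Sigma11_pos {H : ℝ} (h1 : H < 1) : 0 < Sigma11 H := by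
  have h : 0 ≤ ∑' k, term11 H k := tsum_nonneg fun k => sq_nonneg _
  have := cH_pos h1
  rw [Sigma11]
  positivity

theorem sqrt_two_mul_Sigma12_le (H : Set.Ioo (0 : ℝ) 1) : √2 * Sigma12 H ≤ Sigma11 H := by
  have lim := tendsto_inner_sub_smul_diffKernel (H := H) one_pos
    (tendsto_const_nhds (x := (1 : ℝ))) (tendsto_const_nhds (x := √2 / 2))
  have limit_nonneg := ge_of_tendsto' lim fun n =>
    mul_nonneg (inv_nonneg.2 (Nat.cast_nonneg n))
      (real_inner_self_nonneg (F := CMSpace H 1 ⊗[ℝ] CMSpace H 1))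
  have hc := cH_pos H.2.2
  have h2 : √2 ^ 2 = (2 : ℝ) := Real.sq_sqrt zero_le_two
  rw [Sigma11_eq_tsum H.2.1 H.2.2, Sigma12, two_mul (H : ℝ), Real.rpow_add two_pos, ← sub_nonneg]
  rw [div_pow, h2] at limit_nonneg
  refine (mul_nonneg (inv_nonneg.2 (sq_nonneg (cH H))) limit_nonneg).trans_eq ?_
  ring

theorem three_halves_sub_sqrt_two_mul_Sigma11_le (H : Set.Ioo (0 : ℝ) 1) :
    (3 / 2 - √2) * Sigma11 H ≤ 3 / 2 * Sigma11 H - 2 * Sigma12 H := by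
  have h := mul_le_mul_of_nonneg_left (sqrt_two_mul_Sigma12_le H) (Real.sqrt_nonneg 2)
  rw [← mul_assoc, Real.mul_self_sqrt zero_le_two] at h
  linarith

theorem sqrt_two_lt_three_halves : √2 < (3 / 2 : ℝ) := by
  rw [Real.sqrt_lt' (by norm_num)]
  norm_num

end LimitMatrix

section KernelDifference

variable {H : Set.Ioo (0 : ℝ) 1} {T : ℝ}

/-- The factor `n / ((α n - 1) c)` with which `diffKernel` enters `√n f_n^{[α]}`. -/
noncomputable def kernWeight (H : Set.Ioo (0 : ℝ) 1) (α n : ℕ) : ℝ :=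
  n / (((α * n : ℕ) - 1) * cH H)

theorem tendsto_kernWeight (H : Set.Ioo (0 : ℝ) 1) {α : ℕ} (hα : 0 < α) :
    Tendsto (kernWeight H α) atTop (𝓝 (α * cH H)⁻¹) := by
  have hc := (cH_pos H.2.2).ne'
  have lim : Tendsto (fun n : ℕ => (α - 1 / (n : ℝ)) * cH H) atTop (𝓝 ((α - 0) * cH H)) :=
    (tendsto_one_div_atTop_nhds_zero_nat.const_sub _).mul_const _
  rw [sub_zero] at lim
  refine (lim.inv₀ (mul_ne_zero (Nat.cast_ne_zero.2 hα.ne') hc)).congr' ?_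
  filter_upwards [eventually_ne_atTop 0] with n hn
  have hn' : (n : ℝ) ≠ 0 := Nat.cast_ne_zero.2 hn
  rw [kernWeight, Nat.cast_mul, sub_div' hn', div_mul_eq_mul_div, inv_div]

theorem tendsto_kernWeight_one (H : Set.Ioo (0 : ℝ) 1) :
    Tendsto (kernWeight H 1) atTop (𝓝 (cH H)⁻¹) := by
  simpa using tendsto_kernWeight H one_pos

theorem tendsto_kernWeight_two (H : Set.Ioo (0 : ℝ) 1) :
    Tendsto (kernWeight H 2) atTop (𝓝 (2 * cH H)⁻¹) := by
  simpa only [Nat.cast_ofNat] using tendsto_kernWeight H two_pos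

/-- The kernel `f_n^{[1]} - f_n^{[2]}` in explicit form: it represents `M_n` in the second chaos,
and twice its self-contraction represents `G̃_n`. -/
noncomputable def kernDiff (H : Set.Ioo (0 : ℝ) 1) (T : ℝ) (n : ℕ) :
    CMSpace H T ⊗[ℝ] CMSpace H T :=
  (√(n : ℝ))⁻¹ • (kernWeight H 1 n • diffKernel H T n - kernWeight H 2 n • diffKernel H T (2 * n))

theorem comm_kernDiff (n : ℕ) :
    TensorProduct.comm ℝ _ _ (kernDiff H T n) = kernDiff H T n := by
  rw [kernDiff, map_smul, map_sub, map_smul, map_smul, comm_diffKernel, comm_diffKernel]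

theorem tendsto_inner_kernDiff_self (hT : 0 < T) :
    Tendsto (fun n => ⟪kernDiff H T n, kernDiff H T n⟫_ℝ) atTop (𝓝 (matT H 0 0 / 2)) := by
  rw [matT_zero_zero_eq_tsum H.2.1 H.2.2, mul_div_cancel_left₀ _ two_ne_zero]
  refine (tendsto_inner_sub_smul_diffKernel hT (tendsto_kernWeight_one H)
    (tendsto_kernWeight_two H)).congr fun n => ?_
  rw [kernDiff, inner_smul_left_tensor, inner_smul_right_tensor, ← mul_assoc, ← mul_inv,
    Real.mul_self_sqrt (Nat.cast_nonneg n)]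

theorem tendsto_inner_kernDiff_contrₗ (hT : 0 < T) :
    Tendsto (fun n : ℕ =>
        √(n : ℝ) * ⟪kernDiff H T n, contrₗ (kernDiff H T n) (kernDiff H T n)⟫_ℝ)
      atTop (𝓝 (matT H 0 1 / 4)) := by
  rw [matT_zero_one_eq_tsum H.2.2, mul_div_cancel_left₀ _ four_ne_zero]
  refine (tendsto_inner_contrₗ_sub_smul_diffKernel hT (tendsto_kernWeight_one H)
    (tendsto_kernWeight_two H)).congr' ?_
  filter_upwards [eventually_gt_atTop 0] with n hn
  have hs : √(n : ℝ) ≠ 0 := (Real.sqrt_pos.2 (Nat.cast_pos.2 hn)).ne'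
  rw [kernDiff]
  simp only [map_smul, LinearMap.smul_apply, inner_smul_left_tensor, inner_smul_right_tensor]
  rw [mul_inv_cancel_left₀ hs, ← mul_assoc, ← mul_inv, Real.mul_self_sqrt (Nat.cast_nonneg n)]

theorem tendsto_inner_contrₗ_kernDiff_self (hT : 0 < T) :
    Tendsto (fun n : ℕ => (n : ℝ) * ⟪contrₗ (kernDiff H T n) (kernDiff H T n),
        contrₗ (kernDiff H T n) (kernDiff H T n)⟫_ℝ)
      atTop (𝓝 (matT H 1 1 / 8)) := by
  rw [matT_one_one_eq_tsum H.2.2, mul_div_cancel_left₀ _ (by norm_num)]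
  refine (tendsto_inner_contrₗ_self_sub_smul_diffKernel hT (tendsto_kernWeight_one H)
    (tendsto_kernWeight_two H)).congr' ?_
  filter_upwards [eventually_ne_atTop 0] with n hn
  have hn' : (n : ℝ) ≠ 0 := Nat.cast_ne_zero.2 hn
  have sqrt_inv_sq : (√(n : ℝ))⁻¹ * (√(n : ℝ))⁻¹ = (n : ℝ)⁻¹ := by
    rw [← mul_inv, Real.mul_self_sqrt (Nat.cast_nonneg n)]
  rw [kernDiff]
  simp only [map_smul, LinearMap.smul_apply, smul_smul, inner_smul_left_tensor,
    inner_smul_right_tensor, sqrt_inv_sq]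
  rw [mul_inv_cancel_left₀ hn']

theorem tendsto_inner_kernDiff_pair (hT : 0 < T) (i j : Fin 2) :
    Tendsto (fun n : ℕ =>
      ⟪![kernDiff H T n, (2 * √(n : ℝ)) • contrₗ (kernDiff H T n) (kernDiff H T n)] i,
        ![kernDiff H T n, (2 * √(n : ℝ)) • contrₗ (kernDiff H T n) (kernDiff H T n)] j⟫_ℝ)
      atTop (𝓝 (((2⁻¹ : ℝ) • matT H) i j)) := by
  have mixed : Tendsto (fun n : ℕ =>
      ⟪kernDiff H T n, (2 * √(n : ℝ)) • contrₗ (kernDiff H T n) (kernDiff H T n)⟫_ℝ)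
      atTop (𝓝 (2⁻¹ * matT H 0 1)) := by
    simp only [inner_smul_right_tensor, mul_assoc]
    convert (tendsto_inner_kernDiff_contrₗ (H := H) hT).const_mul 2 using 2
    ring
  have contracted : Tendsto (fun n : ℕ =>
      ⟪(2 * √(n : ℝ)) • contrₗ (kernDiff H T n) (kernDiff H T n),
        (2 * √(n : ℝ)) • contrₗ (kernDiff H T n) (kernDiff H T n)⟫_ℝ)
      atTop (𝓝 (2⁻¹ * matT H 1 1)) := by
    convert (tendsto_inner_contrₗ_kernDiff_self (H := H) hT).const_mul 4 using 2 with n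
    · rw [inner_smul_left_tensor, inner_smul_right_tensor, ← mul_assoc, mul_mul_mul_comm,
        Real.mul_self_sqrt (Nat.cast_nonneg n), ← mul_assoc]
      norm_num
    · ring
  rw [Matrix.smul_apply, smul_eq_mul]
  fin_cases i <;> fin_cases j
  · exact inv_mul_eq_div (2 : ℝ) _ ▸ tendsto_inner_kernDiff_self hT
  · exact mixed
  · exact mixed.congr fun n => real_inner_comm (F := CMSpace H T ⊗[ℝ] CMSpace H T) _ _
  · exact contracted

theorem exists_eventually_abs_inner_kernDiff_tmul_self_le (hT : 0 < T) :
    ∃ K, ∀ᶠ n : ℕ in atTop, ∀ e : CMSpace H T, ‖e‖ = 1 →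
      |⟪kernDiff H T n, e ⊗ₜ[ℝ] e⟫_ℝ| ≤ K * (√(n : ℝ))⁻¹ := by
  have weight_le : ∀ {α : ℕ}, 0 < α → ∀ᶠ n in atTop, |kernWeight H α n| ≤ |(α * cH H)⁻¹| + 1 :=
    fun hα => ((tendsto_kernWeight H hα).abs.eventually (gt_mem_nhds (lt_add_one _))).mono
      fun _ => le_of_lt
  set L := ∑' j, |rhoHat H j|
  refine ⟨(|((1 : ℕ) * cH H)⁻¹| + 1) * L + (|((2 : ℕ) * cH H)⁻¹| + 1) * L, ?_⟩
  filter_upwards [weight_le one_pos, weight_le two_pos] with n h1 h2 e he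
  have coarse := inner_diffKernel_tmul_self_le (H := H) hT n he
  have fine := inner_diffKernel_tmul_self_le (H := H) hT (2 * n) he
  rw [kernDiff, inner_smul_left_tensor, inner_sub_left, inner_smul_left_tensor,
    inner_smul_left_tensor, abs_mul, abs_of_nonneg (by positivity : 0 ≤ (√(n : ℝ))⁻¹), mul_comm]
  gcongr
  refine (abs_sub _ _).trans ?_
  rw [abs_mul, abs_mul]
  gcongr

theorem matT_posSemidef (H : Set.Ioo (0 : ℝ) 1) : (matT H).PosSemidef := by
  have half : ((2⁻¹ : ℝ) • matT H).PosSemidef :=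
    posSemidef_of_tendsto_inner (x := fun n : ℕ =>
      ![kernDiff H 1 n, (2 * √(n : ℝ)) • contrₗ (kernDiff H 1 n) (kernDiff H 1 n)])
      (tendsto_inner_kernDiff_pair one_pos)
  have h := half.smul (zero_le_two : (0 : ℝ) ≤ 2)
  rwa [smul_smul, mul_inv_cancel₀ two_ne_zero, one_smul] at h

end KernelDifference

section Kernels

variable {H : Set.Ioo (0 : ℝ) 1} {T : ℝ} {Ω : Type*} {mΩ : MeasurableSpace Ω} {P : Measure Ω}
  {W : CMSpace H T → Ω → ℝ}

theorem secondDiff_ae_eq (hW : IsIsonormal W P) (m j : ℕ) :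
    secondDiff W m j =ᵐ[P] W (stepDiff H T m j) := by
  have e : stepDiff H T m j = (-2 : ℝ) • ind H T (grid T m j) +
      ((1 : ℝ) • ind H T (grid T m (j + 1)) + ind H T (grid T m (j - 1))) := by
    rw [stepDiff]; module
  rw [e]
  filter_upwards [hW.ae_eq_smul_add (-2) (ind H T (grid T m j))
      ((1 : ℝ) • ind H T (grid T m (j + 1)) + ind H T (grid T m (j - 1))),
    hW.ae_eq_smul_add 1 (ind H T (grid T m (j + 1))) (ind H T (grid T m (j - 1)))] with ω h1 h2
  rw [h1, h2, secondDiff, fBM, fBM, fBM]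
  ring

theorem integral_secondDiff_sq (hW : IsIsonormal W P) (m j : ℕ) :
    ∫ ω, secondDiff W m j ω ^ 2 ∂P = ‖stepDiff H T m j‖ ^ 2 := by
  rw [← real_inner_self_eq_norm_sq, ← hW.covariance]
  refine integral_congr_ae ?_
  filter_upwards [secondDiff_ae_eq hW m j] with ω h
  rw [h, sq]

theorem memLp_secondDiff (hW : IsIsonormal W P) (m j : ℕ) : MemLp (secondDiff W m j) 2 P :=
  (memLp_congr_ae (secondDiff_ae_eq hW m j)).2 (hW.memLp _)

theorem meanV₂_eq_sum (hW : IsIsonormal W P) (m : ℕ) :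
    meanV₂ W P m = ∑ j ∈ Finset.Ico 1 m, ‖stepDiff H T m j‖ ^ 2 := by
  simp only [meanV₂, V₂]
  rw [integral_finsetSum _ fun j _ => (memLp_secondDiff hW m j).integrable_sq]
  exact Finset.sum_congr rfl fun j _ => integral_secondDiff_sq hW m j

theorem meanV₂_eq (hT : 0 < T) (hW : IsIsonormal W P) {m : ℕ} (hm : 0 < m) :
    meanV₂ W P m = ((m : ℝ) - 1) * ((T / m) ^ (2 * (H : ℝ)) * cH H) := by
  have norm_sq : ∀ j ∈ Finset.Ico 1 m, ‖stepDiff H T m j‖ ^ 2 = (T / m) ^ (2 * (H : ℝ)) * cH H :=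
    fun j hj => by
      rw [← real_inner_self_eq_norm_sq, inner_stepDiff hT hj hj, sub_self, rhoHat_zero H.2.1]
  rw [meanV₂_eq_sum hW, Finset.sum_congr rfl norm_sq, Finset.sum_const, Nat.card_Ico, nsmul_eq_mul,
    Nat.cast_sub hm, Nat.cast_one]

theorem meanV₂_pos (hT : 0 < T) (hW : IsIsonormal W P) {m : ℕ} (hm : 1 < m) :
    0 < meanV₂ W P m := by
  have hm1 : (1 : ℝ) < m := Nat.one_lt_cast.2 hm
  rw [meanV₂_eq hT hW (by omega)]
  exact mul_pos (by linarith) (mul_pos (by positivity) (cH_pos H.2.2))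

theorem V₂_sub_meanV₂_ae_eq (hW : IsIsonormal W P) (m : ℕ) :
    (fun ω => V₂ W m ω - meanV₂ W P m) =ᵐ[P]
      hW.I₂ (∑ j ∈ Finset.Ico 1 m, stepDiff H T m j ⊗ₜ[ℝ] stepDiff H T m j) := by
  have chaos := hW.I₂_sum_smul_tmul_self_ae (Finset.Ico 1 m) (fun _ => 1) (stepDiff H T m)
  simp only [one_smul, one_mul] at chaos
  have secondDiff_eq : ∀ᵐ ω ∂P, ∀ j ∈ Finset.Ico 1 m,
      secondDiff W m j ω = W (stepDiff H T m j) ω :=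
    (Finset.eventually_all _).2 fun j _ => secondDiff_ae_eq hW m j
  filter_upwards [chaos, secondDiff_eq] with ω h1 h2
  rw [h1, V₂, meanV₂_eq_sum hW, ← Finset.sum_sub_distrib]
  exact Finset.sum_congr rfl fun j hj => by rw [h2 j hj]

theorem sum_stepDiff_tmul_self (hT : 0 < T) {m : ℕ} (hm : 0 < m) :
    ∑ j ∈ Finset.Ico 1 m, stepDiff H T m j ⊗ₜ[ℝ] stepDiff H T m j =
      (T / m) ^ (2 * (H : ℝ)) • diffKernel H T m := by
  have hTm : 0 < (T / m) := by positivity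
  have hs := (Real.rpow_pos_of_pos hTm (H : ℝ)).ne'
  rw [diffKernel, Finset.smul_sum]
  refine Finset.sum_congr rfl fun j _ => ?_
  rw [scaledDiff, TensorProduct.smul_tmul_smul, smul_smul, two_mul, Real.rpow_add hTm,
    ← mul_inv, mul_inv_cancel₀ (mul_ne_zero hs hs), one_smul]

theorem kern_eq (hT : 0 < T) (hW : IsIsonormal W P) (α n : ℕ) :
    kern W P α n = ((√(n : ℝ))⁻¹ * kernWeight H α n) • diffKernel H T (α * n) := by
  rcases Nat.eq_zero_or_pos (α * n) with h | h
  · rw [kern, h, diffKernel]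
    simp
  · have hTm : ((T / (α * n : ℕ)) ^ (2 * (H : ℝ))) ≠ 0 :=
      (Real.rpow_pos_of_pos (div_pos hT (Nat.cast_pos.2 h)) _).ne'
    rw [kern, sum_stepDiff_tmul_self hT h, smul_smul, meanV₂_eq hT hW h, kernWeight]
    congr 1
    rw [mul_left_comm _ _ (cH (H : ℝ)), div_mul_eq_mul_div, mul_comm, mul_div_mul_left _ _ hTm,
      ← mul_div_assoc, inv_mul_eq_div, Real.div_sqrt]

theorem kern_one_sub_kern_two (hT : 0 < T) (hW : IsIsonormal W P) (n : ℕ) :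
    kern W P 1 n - kern W P 2 n = kernDiff H T n := by
  rw [kernDiff, kern_eq hT hW, kern_eq hT hW, one_mul, smul_sub, smul_smul, smul_smul]

theorem M_ae_eq (hT : 0 < T) (hW : IsIsonormal W P) {n : ℕ} (hn : 1 < n) :
    M W P n =ᵐ[P] hW.I₂ (kernDiff H T n) := by
  have hn1 := (meanV₂_pos hT hW hn).ne'
  have hn2 := (meanV₂_pos hT hW (by omega : 1 < 2 * n)).ne'
  rw [← kern_one_sub_kern_two hT hW, kern, kern, map_sub, map_smul, map_smul, one_mul]
  filter_upwards [V₂_sub_meanV₂_ae_eq hW n, V₂_sub_meanV₂_ae_eq hW (2 * n),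
    AEEqFun.coeFn_sub ((√(n : ℝ) / meanV₂ W P n) • hW.I₂ _) _,
    AEEqFun.coeFn_smul (√(n : ℝ) / meanV₂ W P n) (hW.I₂ _),
    AEEqFun.coeFn_smul (√(n : ℝ) / meanV₂ W P (2 * n)) (hW.I₂ _)]
    with ω coarse fine h_sub h_smul₁ h_smul₂
  rw [h_sub, Pi.sub_apply, h_smul₁, h_smul₂, Pi.smul_apply, Pi.smul_apply, ← coarse, ← fine, M,
    smul_eq_mul, smul_eq_mul]
  field_simp
  ring

theorem aemeasurable_M (hW : IsIsonormal W P) (n : ℕ) : AEMeasurable (M W P n) P := by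
  have aemeasurable_V₂ : ∀ m, AEMeasurable (V₂ W m) P := fun m =>
    Finset.aemeasurable_fun_sum _ fun j _ =>
      (memLp_secondDiff hW m j).aestronglyMeasurable.aemeasurable.pow_const 2
  exact ((((aemeasurable_V₂ (2 * n)).div_const _).sub_const 1).sub
    (((aemeasurable_V₂ n).div_const _).sub_const 1)).const_mul _

theorem Gtilde_eq (hT : 0 < T) (hW : IsIsonormal W P) (n : ℕ) :
    Gtilde hW n = hW.I₂ ((2 : ℝ) • contrₗ (kernDiff H T n) (kernDiff H T n)) := by
  have symContr₁_eq : symContr₁ (kern W P 2 n) (kern W P 1 n) =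
      (1 / 2 : ℝ) • (contrₗ (kern W P 2 n) (kern W P 1 n)
        + contrₗ (kern W P 1 n) (kern W P 2 n)) := by
    rw [symContr₁, ← contrₗ_apply, comm_contrₗ]
  rw [Gtilde, symContr₁_eq, ← contrₗ_apply, ← contrₗ_apply, ← kern_one_sub_kern_two hT hW]
  simp only [map_sub, map_smul, map_add, LinearMap.sub_apply]
  module

theorem sqrt_mul_Gtilde_ae_eq (hT : 0 < T) (hW : IsIsonormal W P) (n : ℕ) :
    (fun ω => √(n : ℝ) * Gtilde hW n ω) =ᵐ[P]
      hW.I₂ ((2 * √(n : ℝ)) • contrₗ (kernDiff H T n) (kernDiff H T n)) := by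
  rw [mul_comm, ← smul_smul, map_smul, ← Gtilde_eq hT]
  exact (AEEqFun.coeFn_smul √(n : ℝ) (Gtilde hW n)).symm

theorem aemeasurable_M_Gtilde (hW : IsIsonormal W P) (n : ℕ) :
    AEMeasurable
      (fun ω => (!₂[M W P n ω, √(n : ℝ) * Gtilde hW n ω] : EuclideanSpace ℝ (Fin 2))) P := by
  have hG := (Gtilde hW n).aestronglyMeasurable.aemeasurable.const_mul √(n : ℝ)
  refine (WithLp.measurable_toLp 2 _).comp_aemeasurable (aemeasurable_pi_lambda _ fun i => ?_)
  fin_cases i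
  · exact aemeasurable_M hW n
  · exact hG

theorem tendstoInDistribution_M_Gtilde [IsProbabilityMeasure P] (hT : 0 < T)
    (hW : IsIsonormal W P) :
    TendstoInDistribution
      (fun (n : ℕ) ω => (!₂[M W P n ω, √(n : ℝ) * Gtilde hW n ω] : EuclideanSpace ℝ (Fin 2)))
      atTop id (fun _ => P) (multivariateGaussian 0 (matT H)) := by
  obtain ⟨K, hK⟩ := exists_eventually_abs_inner_kernDiff_tmul_self_le (H := H) hT
  have sqrt_inv : Tendsto (fun n : ℕ => (√(n : ℝ))⁻¹) atTop (𝓝 0) :=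
    tendsto_inv_atTop_zero.comp (Real.tendsto_sqrt_atTop.comp tendsto_natCast_atTop_atTop)
  have bound : Tendsto (fun n : ℕ => K * (√(n : ℝ))⁻¹) atTop (𝓝 0) := by
    simpa using sqrt_inv.const_mul K
  have chaos := hW.tendstoInDistribution_I₂_contrₗ_self comm_kernDiff bound
    (c := fun n => 2 * √(n : ℝ)) ?_ hK (tendsto_inner_kernDiff_pair hT)
  · rw [smul_smul, mul_inv_cancel₀ two_ne_zero, one_smul] at chaos
    refine tendstoInDistribution_congr' ?_ (aemeasurable_M_Gtilde hW) chaos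
    filter_upwards [eventually_gt_atTop 1] with n hn
    filter_upwards [M_ae_eq hT hW hn, sqrt_mul_Gtilde_ae_eq hT hW n] with ω hM hG
    ext i
    fin_cases i
    · exact hM.symm
    · exact hG.symm
  · have lim := sqrt_inv.const_mul (2 * K ^ 2)
    rw [mul_zero] at lim
    refine lim.congr fun n => ?_
    rcases eq_or_ne √(n : ℝ) 0 with h | h
    · simp [h]
    · field_simp

end Kernels

end FracBM

theorem corollary2108140225 (H : Set.Ioo (0 : ℝ) 1) (T : ℝ) (hT : 0 < T)
    {Ω : Type*} [MeasurableSpace Ω] (P : Measure Ω) [IsProbabilityMeasure P]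
    (W : FracBM.CMSpace H T → Ω → ℝ) (hW : FracBM.IsIsonormal W P) :
    FracBM.SeriesConverge H ∧
    (FracBM.matT H).PosSemidef ∧
    TendstoInDistribution
      (fun (n : ℕ) (ω : Ω) =>
        (!₂[FracBM.M W P n ω, √(n : ℝ) * FracBM.Gtilde hW n ω] : EuclideanSpace ℝ (Fin 2)))
      atTop id (fun _ => P) (multivariateGaussian 0 (FracBM.matT H)) ∧
    FracBM.Ginf H = FracBM.matT H 0 0 ∧
    FracBM.matT H 0 0 = FracBM.Sigma22 H - 2 * FracBM.Sigma12 H + FracBM.Sigma11 H ∧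
    FracBM.matT H 0 0 = 3 / 2 * FracBM.Sigma11 H - 2 * FracBM.Sigma12 H ∧
    (3 / 2 - √2) * FracBM.Sigma11 H ≤ FracBM.matT H 0 0 ∧
    0 < (3 / 2 - √2) * FracBM.Sigma11 H := by
  have h00 := FracBM.matT_zero_zero H
  have h00' : FracBM.matT H 0 0 = 3 / 2 * FracBM.Sigma11 H - 2 * FracBM.Sigma12 H := by
    rw [h00, FracBM.Sigma22]
    ring
  exact ⟨FracBM.seriesConverge H.2.2, FracBM.matT_posSemidef H,
    FracBM.tendstoInDistribution_M_Gtilde hT hW, h00.symm, h00, h00',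
    h00' ▸ FracBM.three_halves_sub_sqrt_two_mul_Sigma11_le H,
    mul_pos (sub_pos.2 FracBM.sqrt_two_lt_three_halves) (FracBM.Sigma11_pos H.2.2)⟩
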